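/- **Setting.** For $K\ge 1$ consider Wyner's symmetric linear network with $K$ transmitters (Txs) and $K$ receivers (Rxs), each with $\mathsf L$ antennas. Put $\mathcal N(k)=\{k-1,k+1\}\cap\{1,\dots,K\}$. At blocklength $n$ and power $\mathsf P$, Tx $k$ has independent messages $M_k^{(F)}$ ("fast") and $M_k^{(S)}$ ("slow"), uniform on $\{1,\dots,\lfloor 2^{nR_k^{(F)}}\rfloor\}$ and $\{1,\dots,\lfloor 2^{nR_k^{(S)}}\rfloor\}$, where $R_k^{(F)},R_k^{(S)}\ge 0$; the messages of different Txs are independent. * Numbers of rounds $\mathsf D_{\mathrm{Tx}},\mathsf D_{\mathrm{Rx}}\ge 0$ with $\mathsf D_{\mathrm{Tx}}+\mathsf D_{\mathrm{Rx}}\le \mathsf D$ are chosen. In round $j\le \mathsf D_{\mathrm{Tx}}$, Tx $k$ sends to each $\ell\in\mathcal N(k)$ a message $T^{(j)}_{k\to\ell}$ that is a function of $M_k^{(S)}$ and of the messages it received in rounds $1,\dots,j-1$, with $\sum_{j} H(T^{(j)}_{k\to \ell})\le \mu_{\mathrm{Tx}}\frac n2\log_2\mathsf P$. * The input $\mathbf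 X_k^n\in\mathbb R^{\mathsf L\times n}$ is a function of $M_k^{(F)}$, $M_k^{(S)}$ and all cooperation messages received by Tx $k$, with $\frac1n\sum_{t=1}^n\|\mathbf X_{k,t}\|^2\le\mathsf P$ almost surely. * Rx $k$ observes $\mathbf Y_{k,t}=\mathsf H_{k,k}\mathbf X_{k,t}+\sum_{i\in\mathcal N(k)}\mathsf H_{i,k}\mathbf X_{i,t}+\mathbf Z_{k,t}$ with i.i.d. standard Gaussian noise independent of the messages and of the noises at the other Rxs. The channel matrices $\mathsf H_{k,k}$ and $\mathsf H_{i,k}$, $i\in\mathcal N(k)$, are fixed real full-rank $\mathsf L\times\mathsf L$ matrices (they may depend on $K$ but not on $n$ or $\mathsf P$). * Rx $k$ decodes $M_k^{(F)}$ from $\mathbf Y_k^n$ alone. Then, in round $j\le \mathsf D_{\mathrm{Rx}}$, Rx $k$ sends to each $\ell\in\mathcal N(k)$ a message $Q^{(j)}_{k\to\ell}$ that is a function of $\mathbf Y_k^n$ and of the messages it received in rounds $1,\dots,j-1$, with $\sum_j H(Q^{(j)}_{k\to\ell})\le\mu_{\mathrm{Rx}}\frac n2\log_2\mathsf P$. Finally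 Rx $k$ decodes $M_k^{(S)}$ from $\mathbf Y_k^n$ and all cooperation messages it received. Average rates $(\bar R^{(F)},\bar R^{(S)})$ are achievable for $K,\mathsf P$ if there are rates with $\bar R^{(F)}=\frac1K\sum_k R_k^{(F)}$, $\bar R^{(S)}=\frac1K\sum_k R_k^{(S)}$ and, for every $n$, encoding, cooperation and decoding functions as above, such that the probability that some message is decoded incorrectly tends to $0$ as $n\to\infty$. A pair $(\mathsf S^{(F)},\mathsf S^{(S)})\in\mathbb R^2$ is an achievable multiplexing-gain (MG) pair if for all $K\ge1$ and $\mathsf P>1$ there are achievable average rates $\bar R_K^{(F)}(\mathsf P),\bar R_K^{(S)}(\mathsf P)$ for which $$\Big(\frac{\bar R_K^{(F)}(\mathsf P)}{\frac12\log_2\mathsf P},\ \frac{\bar R_K^{(S)}(\mathsf P)}{\frac12\log_2\mathsf P}\Big)$$ tends to $(\mathsf S^{(F)},\mathsf S^{(S)})$ when first $\mathsf P\to\infty$ and then $K\to\infty$, along suitable sequences of powers and of network sizes that are the same for both components. That is, there are network sizes $K_i\to\infty$, powers $\mathsf P_{i,j}\to\infty$ as $j\to\infty$ for each $i$, and pairs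 $s_i\in\mathbb R^2$, such that for each $i$ the normalized pair at $(K_i,\mathsf P_{i,j})$ tends to $s_i$ as $j\to\infty$, and $s_i\to(\mathsf S^{(F)},\mathsf S^{(S)})$ as $i\to\infty$. The optimal MG region $\mathcal S^\star(\mu_{\mathrm{Tx}},\mu_{\mathrm{Rx}},\mathsf D)$ is the closure in $\mathbb R^2$ of the set of achievable MG pairs. **Claim.** For all $\mathsf L$, all integers $\mathsf D\ge0$ and all $\mu_{\mathrm{Tx}},\mu_{\mathrm{Rx}}\ge0$, every pair $(\mathsf S^{(F)},\mathsf S^{(S)})\in\mathcal S^\star(\mu_{\mathrm{Tx}},\mu_{\mathrm{Rx}},\mathsf D)$ satisfies $$\mathsf S^{(F)}\le\frac{\mathsf L}{2},\qquad \mathsf S^{(F)}+\mathsf S^{(S)}\le \mathsf L\cdot\frac{\mathsf D+1}{\mathsf D+2}.$$ -/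

import Mathlib

open MeasureTheory ProbabilityTheory Filter Topology
open scoped NNReal ENNReal

noncomputable section

namespace WynerSym

/-- The cells adjacent to cell `k` in the linear network with `K` cells (indices outside of the
network are ignored). In Wyner's symmetric model this set is the interference set, the
Tx-neighbouring set and the Rx-neighbouring set of `k` at the same time. -/
def neighbours {K : ℕ} (k : Fin K) : Finset (Fin K) :=
  Finset.univ.filter fun l => l.val + 1 = k.val ∨ k.val + 1 = l.val

/-- A block of `n` vectors with `L` real entries: the inputs of one Tx or the outputs of one Rx. -/
abbrev Block (L n : ℕ) : Type := Fin n → Fin L → ℝ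

/-- The conferencing messages that terminal `k` received from its neighbours in the first `j`
rounds. The alphabet `ℕ` represents every countable alphabet. -/
abbrev Received {K : ℕ} (k : Fin K) (j : ℕ) : Type := {l // l ∈ neighbours k} → Fin j → ℕ

/-- The number `⌊2 ^ (n R)⌋` of messages at rate `R` and blocklength `n`. -/
def numMessages (n : ℕ) (R : ℝ) : ℕ := ⌊(2 : ℝ) ^ ((n : ℝ) * R)⌋₊

/-- The tuples of all fast messages and all slow messages. -/
abbrev Messages {K : ℕ} (mF mS : Fin K → ℕ) : Type :=
  ((k : Fin K) → Fin (mF k)) × ((k : Fin K) → Fin (mS k))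

/-- A conferencing protocol `φ` gives the message `φ j k l` that terminal `k` sends to terminal `l`
in round `j` (counted from `0`), as a function of the local data of `k` and of what `k` received
in the rounds before. `conference φ s j k l` is the message that is sent if `s` are the local data.
Only the messages to neighbouring terminals are ever used. -/
def conference {K : ℕ} {S : Fin K → Type}
    (φ : (j : ℕ) → (k l : Fin K) → S k → Received k j → ℕ) (s : (k : Fin K) → S k) :
    ℕ → Fin K → Fin K → ℕ
  | j, k, l => φ j k l (s k) fun l' i => conference φ s i.val l'.val k
termination_by j => j
decreasing_by exact i.isLt

/-- What terminal `k` received during the first `r` rounds of the conference. -/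
def received {K : ℕ} {S : Fin K → Type}
    (φ : (j : ℕ) → (k l : Fin K) → S k → Received k j → ℕ) (s : (k : Fin K) → S k)
    (r : ℕ) (k : Fin K) : Received k r :=
  fun l' i => conference φ s i.val l'.val k

/-- The encoding, cooperation and decoding functions for blocklength `n` with a total of at most `D`
cooperation rounds. Tx-conferencing starts from the slow messages only; the fast decoder has only
the outputs of its own receiver. -/
structure Code (L K n D : ℕ) (mF mS : Fin K → ℕ) where
  /-- number of Tx-cooperation rounds -/
  DTx : ℕ
  /-- number of Rx-cooperation rounds -/
  DRx : ℕ
  delay : DTx + DRx ≤ D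
  txConf : (j : ℕ) → (k l : Fin K) → Fin (mS k) → Received k j → ℕ
  encode : (k : Fin K) → Fin (mF k) → Fin (mS k) → Received k DTx → Block L n
  decodeFast : (k : Fin K) → Block L n → Fin (mF k)
  measurable_decodeFast : ∀ k, Measurable (decodeFast k)
  rxConf : (j : ℕ) → (k l : Fin K) → Block L n → Received k j → ℕ
  measurable_rxConf : ∀ j k l, Measurable (Function.uncurry (rxConf j k l))
  decodeSlow : (k : Fin K) → Block L n → Received k DRx → Fin (mS k)
  measurable_decodeSlow : ∀ k, Measurable (Function.uncurry (decodeSlow k))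

/-- The entropy in bits of a random variable with values in `ℕ`. -/
def entropy {Ω : Type} [MeasurableSpace Ω] (μ : Measure Ω) (X : Ω → ℕ) : ℝ≥0∞ :=
  ∑' a : ℕ, ENNReal.ofReal (Real.negMulLog (μ.real (X ⁻¹' {a})) / Real.log 2)

/-- The law of all messages and all noises: independent messages, each uniform on its message set,
and independent i.i.d. standard Gaussian noise. -/
def law (L K n : ℕ) (mF mS : Fin K → ℕ) : Measure (Messages mF mS × (Fin K → Block L n)) :=
  (uniformOn (Set.univ : Set (Messages mF mS))).prod
    (Measure.pi fun _ : Fin K => Measure.pi fun _ : Fin n => Measure.pi fun _ : Fin L =>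
      gaussianReal 0 1)

namespace Code

variable {L K n D : ℕ} {mF mS : Fin K → ℕ} (c : Code L K n D mF mS)

/-- The channel inputs of Tx `k`. -/
def input (m : Messages mF mS) (k : Fin K) : Block L n :=
  c.encode k (m.1 k) (m.2 k) (received c.txConf m.2 c.DTx k)

/-- The channel outputs at Rx `k`; `H i k` is the channel matrix from Tx `i` to Rx `k`. -/
def output (H : Fin K → Fin K → Matrix (Fin L) (Fin L) ℝ)
    (ω : Messages mF mS × (Fin K → Block L n)) (k : Fin K) : Block L n :=
  fun t => (H k k).mulVec (c.input ω.1 k t)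
    + ∑ i ∈ neighbours k, (H i k).mulVec (c.input ω.1 i t) + ω.2 k t

/-- The average block-power constraint and the two conferencing rate constraints. -/
structure Admissible (H : Fin K → Fin K → Matrix (Fin L) (Fin L) ℝ) (μTx μRx : ℝ≥0) (P : ℝ) :
    Prop where
  power : ∀ m k, (1 / (n : ℝ)) * ∑ t, ∑ a, c.input m k t a ^ 2 ≤ P
  txRate : ∀ k, ∀ l ∈ neighbours k,
    ∑ j ∈ Finset.range c.DTx,
        entropy (law L K n mF mS) (fun ω => conference c.txConf ω.1.2 j k l)
      ≤ ENNReal.ofReal (μTx * ((n : ℝ) / 2 * Real.logb 2 P))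
  rxRate : ∀ k, ∀ l ∈ neighbours k,
    ∑ j ∈ Finset.range c.DRx,
        entropy (law L K n mF mS) (fun ω => conference c.rxConf (c.output H ω) j k l)
      ≤ ENNReal.ofReal (μRx * ((n : ℝ) / 2 * Real.logb 2 P))

/-- The event that some fast or slow message is decoded incorrectly. -/
def errorEvent (H : Fin K → Fin K → Matrix (Fin L) (Fin L) ℝ) :
    Set (Messages mF mS × (Fin K → Block L n)) :=
  {ω | ∃ k, c.decodeFast k (c.output H ω k) ≠ ω.1.1 k ∨
    c.decodeSlow k (c.output H ω k) (received c.rxConf (c.output H ω) c.DRx k) ≠ ω.1.2 k}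

/-- The probability of error. -/
def errorProb (H : Fin K → Fin K → Matrix (Fin L) (Fin L) ℝ) : ℝ :=
  (law L K n mF mS).real (c.errorEvent H)

end Code

/-- `(rF, rS)` are achievable average rates of fast and slow messages in the network with `K` cells
at power `P`. -/
def AchievableRates (L D K : ℕ) (μTx μRx : ℝ≥0) (H : Fin K → Fin K → Matrix (Fin L) (Fin L) ℝ)
    (P rF rS : ℝ) : Prop :=
  ∃ RF RS : Fin K → ℝ,
    (∀ k, 0 ≤ RF k) ∧ (∀ k, 0 ≤ RS k) ∧
    rF = (1 / (K : ℝ)) * ∑ k, RF k ∧ rS = (1 / (K : ℝ)) * ∑ k, RS k ∧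
    ∃ c : (n : ℕ) →
        Code L K n D (fun k => numMessages n (RF k)) (fun k => numMessages n (RS k)),
      (∀ n, 1 ≤ n → (c n).Admissible H μTx μRx P) ∧
      Tendsto (fun n => (c n).errorProb H) atTop (𝓝 0)

/-- `(S.1, S.2)` is an achievable pair of multiplexing gains: there are achievable average rates for
all `K` and `P` whose normalized pairs, first for `P → ∞` and then for `K → ∞`, accumulate at `S`.
The limit of the fast and of the slow rates is along the same network sizes and powers. -/
def AchievableMGPair (L D : ℕ) (μTx μRx : ℝ≥0)
    (H : (K : ℕ) → Fin K → Fin K → Matrix (Fin L) (Fin L) ℝ) (S : ℝ × ℝ) : Prop :=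
  ∃ rF rS : ℕ → ℝ → ℝ,
    (∀ K, 1 ≤ K → ∀ P, 1 < P → AchievableRates L D K μTx μRx (H K) P (rF K P) (rS K P)) ∧
    ∃ (K : ℕ → ℕ) (P : ℕ → ℕ → ℝ) (s : ℕ → ℝ × ℝ),
      Tendsto K atTop atTop ∧
      (∀ i, Tendsto (P i) atTop atTop) ∧
      (∀ i, Tendsto (fun j => (rF (K i) (P i j) / (1 / 2 * Real.logb 2 (P i j)),
          rS (K i) (P i j) / (1 / 2 * Real.logb 2 (P i j)))) atTop (𝓝 (s i))) ∧
      Tendsto s atTop (𝓝 S)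

/-- The optimal region of multiplexing gains. -/
def optimalMGRegion (L D : ℕ) (μTx μRx : ℝ≥0)
    (H : (K : ℕ) → Fin K → Fin K → Matrix (Fin L) (Fin L) ℝ) : Set (ℝ × ℝ) :=
  closure {S | AchievableMGPair L D μTx μRx H S}

end WynerSym

end

/-!
The converse is a volume argument, without entropies. Fix a set `A` of receivers and a set `C` of
transmitters such that (i) the outputs in `A` allow correct decoders to find the messages on which
the inputs in `C` depend, and (ii) the noiseless outputs in `A` determine all inputs once those in
`C` are known (`Determines`). Then the noise outside of `A` minus a fixed linear image `N` of the
noise in `A` is all the side information that is needed to compute the remaining outputs from those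
in `A`, and hence to decode all messages (`channel_eq_of_genieView_eq`). So, for the different
message tuples, the maps from the noise `z` to the pair of the outputs in `A` and this side
information send the sets of successfully decoded noise to disjoint sets. These maps are shears up
to translation and preserve the volume. The density of `z` is at most a constant to the power `n`
times a Gaussian profile in the image, with variance of order `P` in the `|A| L n` output
coordinates and of order `1` in the others. Summation over the messages shows that their number is
at most `c ^ n * √P ^ (|A| L n)`, up to a constant factor, where `c` depends on neither `n` nor `P`
(`exists_sum_noise_le`). Thus the sum-rate has prelog at most `|A| L`; the capacities of the
conferencing links and the entropies of the conferencing messages play no role.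

For the fast messages, fix all slow ones and let `A = C` be the even cells: each even receiver
decodes the only unknown message in the input of its own transmitter, and its output then gives the
input on its right. For the sum of both, cut the network into groups of `2 D + 4` cells and drop the
outputs of the first and the last cell of each group. With at most `D` conferencing rounds, the two
middle inputs of a group depend only on messages that are decoded from outputs within the group
(`Code.input_eq_of_channel_eq`), and the other inputs follow from the middle outwards
(`determines_groupCells`). So `|A| / K` tends to `(2 D + 2) / (2 D + 4)`; the bounded number of
exceptions at the end of the network is lost as `K → ∞`.
-/

namespace WynerSym

/-! ### Gaussian measures on products -/

/-- A product of measures with densities has the product of the densities as its density. -/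
lemma pi_withDensity_ofReal {ι : Type*} [Fintype ι] {E : Type*} [MeasurableSpace E]
    (μ : Measure E) [SigmaFinite μ] (f : ι → E → ℝ) (hf : ∀ i x, 0 ≤ f i x)
    (hi : ∀ i, Integrable (f i) μ) :
    Measure.pi (fun i => μ.withDensity fun x => ENNReal.ofReal (f i x)) =
      (Measure.pi fun _ : ι => μ).withDensity fun x => ENNReal.ofReal (∏ i, f i (x i)) := by
  have : ∀ i, IsFiniteMeasure (μ.withDensity fun x => ENNReal.ofReal (f i x)) :=
    fun i => isFiniteMeasure_withDensity_ofReal (hi i).2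
  refine Measure.pi_eq fun s hs => ?_
  have hprod : ∀ x : ι → E, (Set.univ.pi s).indicator (fun x => ∏ i, f i (x i)) x
      = ∏ i, (s i).indicator (f i) (x i) := by
    classical
    intro x
    by_cases hx : x ∈ Set.univ.pi s
    · rw [Set.indicator_of_mem hx]
      exact Finset.prod_congr rfl fun i _ => (Set.indicator_of_mem (hx i trivial) _).symm
    · rw [Set.indicator_of_notMem hx]
      simp only [Set.mem_pi, Set.mem_univ, true_implies, not_forall] at hx
      obtain ⟨i, hi⟩ := hx
      exact (Finset.prod_eq_zero (Finset.mem_univ i) (Set.indicator_of_notMem hi _)).symm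
  have hsm : MeasurableSet (Set.univ.pi s) := MeasurableSet.univ_pi hs
  have hint : Integrable (fun x : ι → E => ∏ i, f i (x i)) (Measure.pi fun _ => μ) :=
    Integrable.fintype_prod hi
  have hnn : ∀ x : ι → E, 0 ≤ ∏ i, f i (x i) := fun x => Finset.prod_nonneg fun i _ => hf i _
  rw [withDensity_apply _ hsm, ← ofReal_integral_eq_lintegral_ofReal hint.restrict
    (Eventually.of_forall hnn), ← integral_indicator hsm]
  simp_rw [hprod]
  rw [integral_fintype_prod_eq_prod, ENNReal.ofReal_prod_of_nonneg]
  · refine Finset.prod_congr rfl fun i _ => ?_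
    rw [withDensity_apply _ (hs i), ← ofReal_integral_eq_lintegral_ofReal (hi i).restrict
      (Eventually.of_forall (hf i)), integral_indicator (hs i)]
  · exact fun i _ => integral_nonneg fun x => Set.indicator_nonneg (fun _ _ => hf i _) _

/-- The law of the noise at all receivers over a block. -/
noncomputable def noise (L K n : ℕ) : Measure (Fin K → Block L n) :=
  Measure.pi fun _ : Fin K => Measure.pi fun _ : Fin n => Measure.pi fun _ : Fin L =>
    gaussianReal 0 1

/-- The total energy of a family of blocks. -/
def energy {L K n : ℕ} (z : Fin K → Block L n) : ℝ := ∑ k, ∑ t, ∑ a, z k t a ^ 2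

lemma noise_eq_withDensity (L K n : ℕ) :
    noise L K n = volume.withDensity fun z =>
      ENNReal.ofReal (∏ k, ∏ t, ∏ a, gaussianPDFReal 0 1 (z k t a)) := by
  have h0 : ∀ x, 0 ≤ gaussianPDFReal 0 1 x := gaussianPDFReal_nonneg 0 1
  have h1 : Integrable (gaussianPDFReal 0 1) volume := integrable_gaussianPDFReal 0 1
  have h2 : Integrable (fun y : Fin L → ℝ => ∏ a, gaussianPDFReal 0 1 (y a)) volume :=
    Integrable.fintype_prod fun _ => h1
  have h3 : Integrable (fun y : Block L n => ∏ t, ∏ a, gaussianPDFReal 0 1 (y t a)) volume :=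
    Integrable.fintype_prod (f := fun _ (y : Fin L → ℝ) => ∏ a, gaussianPDFReal 0 1 (y a))
      fun _ => h2
  have e1 : gaussianReal 0 1 = volume.withDensity
      (fun x => ENNReal.ofReal (gaussianPDFReal 0 1 x)) :=
    gaussianReal_of_var_ne_zero 0 one_ne_zero
  rw [noise, e1, pi_withDensity_ofReal _ _ (fun _ => h0) (fun _ => h1), ← volume_pi,
    pi_withDensity_ofReal (ι := Fin n) _ (fun _ (y : Fin L → ℝ) => ∏ a, gaussianPDFReal 0 1 (y a))
      (fun _ y => Finset.prod_nonneg fun _ _ => h0 _) (fun _ => h2), ← volume_pi,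
    pi_withDensity_ofReal (ι := Fin K) _
      (fun _ (y : Block L n) => ∏ t, ∏ a, gaussianPDFReal 0 1 (y t a))
      (fun _ y => Finset.prod_nonneg fun _ _ => Finset.prod_nonneg fun _ _ => h0 _) (fun _ => h3)]
  rfl

/-- The normalizing constants of the Gaussian density are at most `1`, so they may be dropped. -/
lemma noise_apply_le {L K n : ℕ} {s : Set (Fin K → Block L n)} (hs : MeasurableSet s) :
    noise L K n s ≤ ∫⁻ z in s, ENNReal.ofReal (Real.exp (-(energy z / 2))) := by
  rw [noise_eq_withDensity, withDensity_apply _ hs]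
  refine lintegral_mono fun z => ENNReal.ofReal_le_ofReal ?_
  have h : ∀ x, gaussianPDFReal 0 1 x ≤ Real.exp (-(x ^ 2 / 2)) := by
    intro x
    have h2 : (√(2 * Real.pi * ((1 : ℝ≥0) : ℝ)))⁻¹ ≤ 1 := by
      refine inv_le_one_of_one_le₀ (Real.one_le_sqrt.2 ?_)
      have := Real.pi_gt_three
      simp only [NNReal.coe_one]
      linarith
    rw [gaussianPDFReal]
    refine (mul_le_of_le_one_left (Real.exp_nonneg _) h2).trans (le_of_eq ?_)
    congr 1
    simp only [sub_zero, NNReal.coe_one]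
    ring
  have h0 : ∀ x, 0 ≤ gaussianPDFReal 0 1 x := gaussianPDFReal_nonneg 0 1
  have e : Real.exp (-(energy z / 2)) = ∏ k, ∏ t, ∏ a, Real.exp (-(z k t a ^ 2 / 2)) := by
    simp_rw [← Real.exp_sum, energy, Finset.sum_div, Finset.sum_neg_distrib]
  rw [e]
  gcongr with k _ t _ a _
  · exact fun _ _ => Finset.prod_nonneg fun _ _ => Finset.prod_nonneg fun _ _ => h0 _
  · exact fun _ _ => Finset.prod_nonneg fun _ _ => h0 _
  · exact fun _ _ => h0 _
  · exact h _

/-- The Gaussian integral with one weight for each cell. -/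
lemma lintegral_exp_neg_weighted (L K n : ℕ) (b : Fin K → ℝ) (hb : ∀ k, 0 < b k) :
    ∫⁻ w : Fin K → Block L n, ENNReal.ofReal (Real.exp (-∑ k, b k * ∑ t, ∑ a, w k t a ^ 2))
      = ENNReal.ofReal (∏ k, √(Real.pi / b k) ^ (L * n)) := by
  have h1 : ∀ k, Integrable (fun x : ℝ => Real.exp (-b k * x ^ 2)) volume :=
    fun k => integrable_exp_neg_mul_sq (hb k)
  have h2 : ∀ k, Integrable (fun y : Fin L → ℝ => ∏ a, Real.exp (-b k * y a ^ 2)) volume :=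
    fun k => Integrable.fintype_prod fun _ => h1 k
  have h3 : ∀ k, Integrable (fun y : Block L n => ∏ t, ∏ a, Real.exp (-b k * y t a ^ 2)) volume :=
    fun k => Integrable.fintype_prod
      (f := fun _ (y : Fin L → ℝ) => ∏ a, Real.exp (-b k * y a ^ 2)) fun _ => h2 k
  have h4 : Integrable (fun w : Fin K → Block L n =>
      ∏ k, ∏ t, ∏ a, Real.exp (-b k * w k t a ^ 2)) volume :=
    Integrable.fintype_prod
      (f := fun k (y : Block L n) => ∏ t, ∏ a, Real.exp (-b k * y t a ^ 2)) h3
  have e : ∀ w : Fin K → Block L n, Real.exp (-∑ k, b k * ∑ t, ∑ a, w k t a ^ 2)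
      = ∏ k, ∏ t, ∏ a, Real.exp (-b k * w k t a ^ 2) := by
    intro w
    simp_rw [← Real.exp_sum, ← Finset.mul_sum, neg_mul, Finset.sum_neg_distrib]
  simp_rw [e]
  rw [← ofReal_integral_eq_lintegral_ofReal h4 (Eventually.of_forall fun w =>
    Finset.prod_nonneg fun _ _ => Finset.prod_nonneg fun _ _ => Finset.prod_nonneg fun _ _ =>
      Real.exp_nonneg _)]
  congr 1
  rw [integral_fintype_prod_volume_eq_prod
    (fun k (y : Block L n) => ∏ t, ∏ a, Real.exp (-b k * y t a ^ 2))]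
  refine Finset.prod_congr rfl fun k _ => ?_
  rw [integral_fintype_prod_volume_eq_pow
    (fun y : Fin L → ℝ => ∏ a, Real.exp (-b k * y a ^ 2)),
    integral_fintype_prod_volume_eq_pow (fun x : ℝ => Real.exp (-b k * x ^ 2)), integral_gaussian,
    Fintype.card_fin, Fintype.card_fin, pow_mul]

/-- Boundedness of a linear map, in terms of the Euclidean norm. -/
lemma exists_sum_sq_apply_le {L K : ℕ} (f : (Fin K → Fin L → ℝ) →ₗ[ℝ] (Fin K → Fin L → ℝ)) :
    ∃ c : ℝ, 0 ≤ c ∧ ∀ v, ∑ k, ∑ a, f v k a ^ 2 ≤ c * ∑ k, ∑ a, v k a ^ 2 := by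
  set g := LinearMap.toContinuousLinearMap f
  refine ⟨(K * L : ℝ) * ‖g‖ ^ 2, by positivity, fun v => ?_⟩
  have hv : ‖v‖ ^ 2 ≤ ∑ k, ∑ a, v k a ^ 2 := by
    have h0 : 0 ≤ ∑ k, ∑ a, v k a ^ 2 := by positivity
    refine (Real.le_sqrt (norm_nonneg _) h0).1 ?_
    refine (pi_norm_le_iff_of_nonneg (Real.sqrt_nonneg _)).2 fun k =>
      (pi_norm_le_iff_of_nonneg (Real.sqrt_nonneg _)).2 fun a => ?_
    refine Real.le_sqrt_of_sq_le ?_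
    rw [Real.norm_eq_abs, sq_abs]
    exact (Finset.single_le_sum (f := fun a => v k a ^ 2) (fun _ _ => sq_nonneg _)
      (Finset.mem_univ a)).trans (Finset.single_le_sum (f := fun k => ∑ a, v k a ^ 2)
        (fun _ _ => Finset.sum_nonneg fun _ _ => sq_nonneg _) (Finset.mem_univ k))
  have hf : ∀ k a, f v k a ^ 2 ≤ ‖g‖ ^ 2 * ‖v‖ ^ 2 := by
    intro k a
    rw [← mul_pow, ← sq_abs]
    gcongr
    exact (norm_le_pi_norm (f v k) a).trans ((norm_le_pi_norm (f v) k).trans (g.le_opNorm v))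
  calc ∑ k, ∑ a, f v k a ^ 2 ≤ ∑ _k : Fin K, ∑ _a : Fin L, ‖g‖ ^ 2 * ‖v‖ ^ 2 :=
        Finset.sum_le_sum fun k _ => Finset.sum_le_sum fun a _ => hf k a
    _ = (K * L : ℝ) * ‖g‖ ^ 2 * ‖v‖ ^ 2 := by simp; ring
    _ ≤ _ := by gcongr

/-! ### The genie: a volume-preserving map built from the channel -/

/-- The noiseless channel acting on the inputs of all transmitters at one time instant. -/
def hop {L K : ℕ} (H : Fin K → Fin K → Matrix (Fin L) (Fin L) ℝ) :
    (Fin K → Fin L → ℝ) →ₗ[ℝ] (Fin K → Fin L → ℝ) where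
  toFun v k := (H k k).mulVec (v k) + ∑ i ∈ neighbours k, (H i k).mulVec (v i)
  map_add' v w := by
    funext k
    simp only [Pi.add_apply, Matrix.mulVec_add, Finset.sum_add_distrib]
    abel
  map_smul' r v := by
    funext k
    simp only [Pi.smul_apply, Matrix.mulVec_smul, RingHom.id_apply, smul_add, Finset.smul_sum]

/-- Restriction of a vector to the cells in `A`, with value `0` in all other cells. -/
def mask {K : ℕ} (A : Finset (Fin K)) (E : Type*) [AddCommGroup E] [Module ℝ E] :
    (Fin K → E) →ₗ[ℝ] (Fin K → E) where
  toFun v k := if k ∈ A then v k else 0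
  map_add' v w := by
    funext k
    by_cases h : k ∈ A <;> simp [h]
  map_smul' r v := by
    funext k
    by_cases h : k ∈ A <;> simp [h]

lemma mask_of_mem {K : ℕ} {A : Finset (Fin K)} {E : Type*} [AddCommGroup E] [Module ℝ E]
    {k : Fin K} (h : k ∈ A) (v : Fin K → E) : mask A E v k = v k := by
  simp [mask, h]

lemma mask_of_notMem {K : ℕ} {A : Finset (Fin K)} {E : Type*} [AddCommGroup E] [Module ℝ E]
    {k : Fin K} (h : k ∉ A) (v : Fin K → E) : mask A E v k = 0 := by
  simp [mask, h]

/-- The receivers in `A` and the inputs in `C` determine all inputs of the noiseless channel. -/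
def Determines {L K : ℕ} (H : Fin K → Fin K → Matrix (Fin L) (Fin L) ℝ) (A C : Finset (Fin K)) :
    Prop :=
  ∀ v : Fin K → Fin L → ℝ, (∀ k ∈ C, v k = 0) → (∀ k ∈ A, hop H v k = 0) → v = 0

/-- If the outputs in `A` determine the inputs once those in `C` are known, then they determine
the outputs outside of `A` in a linear way. -/
lemma Determines.exists_linearMap {L K : ℕ} {H : Fin K → Fin K → Matrix (Fin L) (Fin L) ℝ}
    {A C : Finset (Fin K)} (h : Determines H A C) :
    ∃ N : (Fin K → Fin L → ℝ) →ₗ[ℝ] (Fin K → Fin L → ℝ),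
      (∀ v, ∀ k ∈ A, N v k = 0) ∧ (∀ v, (∀ k ∈ A, v k = 0) → N v = 0) ∧
      ∀ v, (∀ k ∈ C, v k = 0) → ∀ k ∉ A, N (hop H v) k = hop H v k := by
  -- `N` is: recover the inputs by a left inverse of `G`, then apply the channel outside of `A`.
  set G := (mask C (Fin L → ℝ)).prod ((mask A (Fin L → ℝ)).comp (hop H)) with hG
  have hker : LinearMap.ker G = ⊥ := by
    refine LinearMap.ker_eq_bot'.2 fun v hv => h v (fun k hk => ?_) fun k hk => ?_
    · have := congrFun (congrArg Prod.fst hv) k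
      simpa [hG, mask_of_mem hk] using this
    · have := congrFun (congrArg Prod.snd hv) k
      simpa [hG, mask_of_mem hk] using this
  obtain ⟨g, hg⟩ := G.exists_leftInverse_of_injective hker
  refine ⟨(mask Aᶜ (Fin L → ℝ)).comp ((hop H).comp (g.comp
    ((LinearMap.inr ℝ (Fin K → Fin L → ℝ) (Fin K → Fin L → ℝ)).comp (mask A (Fin L → ℝ))))),
    fun v k hk => ?_, fun v hv => ?_, fun v hv k hk => ?_⟩
  · exact mask_of_notMem (by simpa using hk) _
  · have : mask A (Fin L → ℝ) v = 0 := by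
      funext k
      by_cases hk : k ∈ A
      · rw [mask_of_mem hk, hv k hk]; rfl
      · rw [mask_of_notMem hk]; rfl
    simp only [LinearMap.comp_apply, this, map_zero]
  · have hC : mask C (Fin L → ℝ) v = 0 := by
      funext k
      by_cases hk : k ∈ C
      · rw [mask_of_mem hk, hv k hk]; rfl
      · rw [mask_of_notMem hk]; rfl
    have hv' : g ((LinearMap.inr ℝ (Fin K → Fin L → ℝ) (Fin K → Fin L → ℝ))
        (mask A (Fin L → ℝ) (hop H v))) = v := by
      have := LinearMap.congr_fun hg v
      simpa [hG, hC] using this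
    simp only [LinearMap.comp_apply, hv']
    exact mask_of_mem (by simpa using hk) _

/-- A shear has determinant `±1`: a reflection `D` that anticommutes with `N` conjugates `1 - N`
to its inverse `1 + N`. -/
lemma abs_det_one_sub_eq_one {E : Type*} [AddCommGroup E] [Module ℝ E] (N D : Module.End ℝ E)
    (hD : D * D = 1) (hDN : D * N * D = -N) (hN : N * N = 0) :
    |LinearMap.det (1 - N)| = 1 := by
  have h1 : LinearMap.det D * LinearMap.det D = 1 := by
    rw [← map_mul, hD, map_one]
  have h2 : LinearMap.det (1 + N) = LinearMap.det (1 - N) := by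
    have : 1 + N = D * (1 - N) * D := by
      rw [mul_sub, sub_mul, mul_one, hD, hDN, sub_neg_eq_add]
    rw [this, map_mul, map_mul]
    linear_combination LinearMap.det (1 - N) * h1
  have h3 : LinearMap.det (1 - N) * LinearMap.det (1 - N) = 1 := by
    nth_rewrite 2 [← h2]
    rw [← map_mul]
    have : (1 - N) * (1 + N) = 1 - N * N := by noncomm_ring
    rw [this, hN, sub_zero, map_one]
  rcases mul_self_eq_one_iff.1 h3 with h | h <;> simp [h]

/-- A linear map on the values at one time instant, applied at each time of a block. -/
def overTime {L K : ℕ} (n : ℕ) (N : (Fin K → Fin L → ℝ) →ₗ[ℝ] (Fin K → Fin L → ℝ)) :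
    Module.End ℝ (Fin K → Block L n) where
  toFun z k t := N (fun k => z k t) k
  map_add' z w := by
    funext k t
    exact congrFun (N.map_add (fun k => z k t) (fun k => w k t)) k
  map_smul' r z := by
    funext k t
    exact congrFun (N.map_smul r (fun k => z k t)) k

/-- `N` maps the coordinates in `A` to those outside of `A`, so that changing the sign outside of
`A` anticommutes with `N`. -/
lemma abs_det_one_sub_overTime {L K : ℕ} (n : ℕ) {A : Finset (Fin K)}
    {N : (Fin K → Fin L → ℝ) →ₗ[ℝ] (Fin K → Fin L → ℝ)} (h1 : ∀ v, ∀ k ∈ A, N v k = 0)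
    (h2 : ∀ v, (∀ k ∈ A, v k = 0) → N v = 0) :
    |LinearMap.det (1 - overTime n N)| = 1 := by
  refine abs_det_one_sub_eq_one _ (mask A (Block L n) - mask Aᶜ (Block L n)) ?_ ?_ ?_
  · refine LinearMap.ext fun z => funext fun k => ?_
    by_cases hk : k ∈ A <;> simp [mask, hk]
  · refine LinearMap.ext fun z => funext fun k => funext fun t => ?_
    have e3 : overTime n N ((mask A (Block L n) - mask Aᶜ (Block L n)) z) = overTime n N z := by
      funext k t
      have : N (fun k => (mask A (Block L n) z - mask Aᶜ (Block L n) z) k t)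
          = N fun k => z k t := by
        have e : (fun k => (mask A (Block L n) z - mask Aᶜ (Block L n) z) k t)
            = (fun k => z k t) - (2 : ℝ) • mask Aᶜ (Fin L → ℝ) (fun k => z k t) := by
          funext k a
          by_cases hk : k ∈ A
          · simp [mask, hk]
          · simp [mask, hk]; ring
        rw [e, map_sub, map_smul, h2 _ fun k hk => mask_of_notMem (by simpa using hk) _,
          smul_zero, sub_zero]
      exact congrFun this k
    rw [mul_assoc, Module.End.mul_apply, Module.End.mul_apply, e3]
    by_cases hk : k ∈ A
    · simp [mask, hk, overTime, h1 _ k hk]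
    · simp [mask, hk]
  · refine LinearMap.ext fun z => funext fun k => funext fun t => ?_
    exact congrFun (h2 _ fun k hk => h1 _ k hk) k

instance isAddHaarMeasure_volume_blocks (L K n : ℕ) :
    (volume : Measure (Fin K → Block L n)).IsAddHaarMeasure := by
  have h1 : (volume : Measure (Fin L → ℝ)).IsAddHaarMeasure := inferInstance
  have h2 : (volume : Measure (Fin n → Fin L → ℝ)).IsAddHaarMeasure :=
    Measure.pi.isAddHaarMeasure _
  exact Measure.pi.isAddHaarMeasure _

lemma measurePreserving_one_sub_overTime_add {L K : ℕ} (n : ℕ) {A : Finset (Fin K)}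
    {N : (Fin K → Fin L → ℝ) →ₗ[ℝ] (Fin K → Fin L → ℝ)} (h1 : ∀ v, ∀ k ∈ A, N v k = 0)
    (h2 : ∀ v, (∀ k ∈ A, v k = 0) → N v = 0) (b : Fin K → Block L n) :
    MeasurePreserving (fun z => (1 - overTime n N) z + b) ∧
      MeasurableEmbedding (fun z => (1 - overTime n N) z + b) := by
  set f := 1 - overTime n N
  have hdet : |LinearMap.det f| = 1 := abs_det_one_sub_overTime n h1 h2
  have hdet0 : LinearMap.det f ≠ 0 := by
    intro h
    simp [h] at hdet
  have hc : Continuous f := f.continuous_of_finiteDimensional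
  have hmp : MeasurePreserving f := by
    refine ⟨hc.measurable, ?_⟩
    rw [Measure.map_linearMap_addHaar_eq_smul_addHaar _ hdet0, abs_inv, hdet]
    simp
  have hinj : Function.Injective f :=
    (LinearEquiv.ofIsUnitDet (f := f) (v := Module.finBasis ℝ _) (v' := Module.finBasis ℝ _)
      (by rw [LinearMap.det_toMatrix]; exact isUnit_iff_ne_zero.2 hdet0)).injective
  refine ⟨(measurePreserving_add_right volume b).comp hmp, ?_⟩
  exact (measurableEmbedding_addRight b).comp (hc.measurableEmbedding hinj)

/-! ### The volume bound for codes -/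

/-- The outputs of all receivers for inputs `x` and noise `z`. -/
def channel {L K n : ℕ} (H : Fin K → Fin K → Matrix (Fin L) (Fin L) ℝ)
    (x z : Fin K → Block L n) : Fin K → Block L n :=
  fun k t => hop H (fun i => x i t) k + z k t

/-- What the genie-aided receiver sees: the outputs of the receivers in `A`, and the part of the
noise at the other receivers that `N` does not predict from the noise in `A`. -/
def genieView {L K n : ℕ} (H : Fin K → Fin K → Matrix (Fin L) (Fin L) ℝ) (A : Finset (Fin K))
    (N : (Fin K → Fin L → ℝ) →ₗ[ℝ] (Fin K → Fin L → ℝ)) (x z : Fin K → Block L n) :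
    Fin K → Block L n :=
  (1 - overTime n N) z + fun k t => mask A (Fin L → ℝ) (hop H fun i => x i t) k

lemma genieView_of_mem {L K n : ℕ} {H : Fin K → Fin K → Matrix (Fin L) (Fin L) ℝ}
    {A : Finset (Fin K)} {N : (Fin K → Fin L → ℝ) →ₗ[ℝ] (Fin K → Fin L → ℝ)}
    (h1 : ∀ v, ∀ k ∈ A, N v k = 0) (x z : Fin K → Block L n) {k : Fin K} (hk : k ∈ A) :
    genieView H A N x z k = channel H x z k := by
  funext t
  simp [genieView, channel, overTime, mask_of_mem hk, h1 _ k hk, add_comm]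

lemma genieView_of_notMem {L K n : ℕ} {H : Fin K → Fin K → Matrix (Fin L) (Fin L) ℝ}
    {A : Finset (Fin K)} {N : (Fin K → Fin L → ℝ) →ₗ[ℝ] (Fin K → Fin L → ℝ)}
    (x z : Fin K → Block L n) {k : Fin K} (hk : k ∉ A) (t : Fin n) :
    genieView H A N x z k t = z k t - N (fun i => z i t) k := by
  simp [genieView, overTime, mask_of_notMem hk]

/-- If the inputs in `C` agree, then equal views imply equal outputs at all receivers. -/
lemma channel_eq_of_genieView_eq {L K n : ℕ} {H : Fin K → Fin K → Matrix (Fin L) (Fin L) ℝ}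
    {A C : Finset (Fin K)} {N : (Fin K → Fin L → ℝ) →ₗ[ℝ] (Fin K → Fin L → ℝ)}
    (h1 : ∀ v, ∀ k ∈ A, N v k = 0) (h2 : ∀ v, (∀ k ∈ A, v k = 0) → N v = 0)
    (h3 : ∀ v, (∀ k ∈ C, v k = 0) → ∀ k ∉ A, N (hop H v) k = hop H v k)
    {x x' z z' : Fin K → Block L n} (hx : ∀ k ∈ C, x k = x' k)
    (h : genieView H A N x z = genieView H A N x' z') :
    channel H x z = channel H x' z' := by
  funext k t
  by_cases hk : k ∈ A
  · rw [← genieView_of_mem h1 x z hk, ← genieView_of_mem h1 x' z' hk, h]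
  · -- The outputs in `A` agree, so the noise and the noiseless outputs differ there oppositely.
    have hA : N ((hop H ((fun i => x i t) - fun i => x' i t))
        + ((fun i => z i t) - fun i => z' i t)) = 0 := by
      refine h2 _ fun l hl => ?_
      have e : channel H x z l t = channel H x' z' l t := by
        rw [← genieView_of_mem h1 x z hl, ← genieView_of_mem h1 x' z' hl, h]
      simp only [channel] at e
      simp only [map_sub, Pi.add_apply, Pi.sub_apply]
      rw [sub_add_sub_comm, e, sub_self]
    have hC := h3 ((fun i => x i t) - fun i => x' i t)
      (fun l hl => by simp [hx l hl]) k hk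
    have hV := congrFun (congrFun h k) t
    rw [genieView_of_notMem x z hk, genieView_of_notMem x' z' hk] at hV
    have hA' := congrFun hA k
    rw [map_add, Pi.add_apply, hC] at hA'
    simp only [map_sub, Pi.sub_apply, Pi.zero_apply] at hA'
    simp only [channel]
    have e1 : hop H (fun i => x i t) k + z k t - (hop H (fun i => x' i t) k + z' k t)
        = (hop H (fun i => x i t) k - hop H (fun i => x' i t) k
          + (N (fun i => z i t) k - N (fun i => z' i t) k))
          + ((z k t - N (fun i => z i t) k) - (z' k t - N (fun i => z' i t) k)) := by abel
    rw [← sub_eq_zero, e1, hA', hV, sub_self, add_zero]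

/-- Weighting the outputs in `A` by the inverse power makes the energy of the genie's view
comparable to the energy of the noise, uniformly in the blocklength and the power. -/
lemma exists_weighted_genieView_le {L K : ℕ} (H : Fin K → Fin K → Matrix (Fin L) (Fin L) ℝ)
    (A : Finset (Fin K)) {N : (Fin K → Fin L → ℝ) →ₗ[ℝ] (Fin K → Fin L → ℝ)}
    (h1 : ∀ v, ∀ k ∈ A, N v k = 0) :
    ∃ c : ℝ, 0 < c ∧ ∀ (n : ℕ) (P : ℝ), 1 ≤ P → ∀ x z : Fin K → Block L n,
      (∀ k, ∑ t, ∑ a, x k t a ^ 2 ≤ n * P) →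
      ∑ k, (if k ∈ A then P⁻¹ else 1) * ∑ t, ∑ a, genieView H A N x z k t a ^ 2
        ≤ c * (n + energy z) := by
  obtain ⟨c1, hc1, hop_le⟩ := exists_sum_sq_apply_le (hop H)
  obtain ⟨c2, hc2, N_le⟩ := exists_sum_sq_apply_le N
  refine ⟨2 * c1 * K + 2 + 2 * c2, by positivity, fun n P hP x z hx => ?_⟩
  have hP0 : 0 < P := by linarith
  have hP1 : P⁻¹ ≤ 1 := inv_le_one_of_one_le₀ hP
  set X : Fin K → ℝ := fun k => ∑ t, ∑ a, hop H (fun i => x i t) k a ^ 2 with hX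
  set Z : Fin K → ℝ := fun k => ∑ t, ∑ a, z k t a ^ 2 with hZ
  set W : Fin K → ℝ := fun k => ∑ t, ∑ a, N (fun i => z i t) k a ^ 2 with hW
  have X0 : ∀ k, 0 ≤ X k := fun k => by positivity
  have Z0 : ∀ k, 0 ≤ Z k := fun k => by positivity
  have W0 : ∀ k, 0 ≤ W k := fun k => by positivity
  have key : ∀ k, (if k ∈ A then P⁻¹ else 1) * ∑ t, ∑ a, genieView H A N x z k t a ^ 2
      ≤ 2 * P⁻¹ * X k + 2 * Z k + 2 * W k := by
    intro k
    by_cases hk : k ∈ A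
    · have h : ∑ t, ∑ a, genieView H A N x z k t a ^ 2 ≤ 2 * X k + 2 * Z k := by
        rw [genieView_of_mem h1 x z hk, hX, hZ]
        simp only [Finset.mul_sum _ _ (2 : ℝ), ← Finset.sum_add_distrib]
        exact Finset.sum_le_sum fun t _ => Finset.sum_le_sum fun a _ => by
          simp only [channel, Pi.add_apply]
          nlinarith [sq_nonneg (hop H (fun i => x i t) k a - z k t a)]
      rw [if_pos hk]
      calc P⁻¹ * ∑ t, ∑ a, genieView H A N x z k t a ^ 2 ≤ P⁻¹ * (2 * X k + 2 * Z k) := by gcongr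
        _ = 2 * P⁻¹ * X k + P⁻¹ * (2 * Z k) := by ring
        _ ≤ 2 * P⁻¹ * X k + 1 * (2 * Z k) := by
          gcongr
        _ ≤ _ := by linarith [W0 k]
    · have h : ∑ t, ∑ a, genieView H A N x z k t a ^ 2 ≤ 2 * Z k + 2 * W k := by
        rw [hW, hZ]
        simp only [Finset.mul_sum _ _ (2 : ℝ), ← Finset.sum_add_distrib]
        exact Finset.sum_le_sum fun t _ => Finset.sum_le_sum fun a _ => by
          rw [genieView_of_notMem x z hk]
          simp only [Pi.sub_apply]
          nlinarith [sq_nonneg (N (fun i => z i t) k a + z k t a)]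
      rw [if_neg hk, one_mul]
      have : 0 ≤ 2 * P⁻¹ * X k := mul_nonneg (by positivity) (X0 k)
      linarith
  have comm : ∀ g : Fin K → Fin n → Fin L → ℝ,
      ∑ k, ∑ t, ∑ a, g k t a = ∑ t, ∑ k, ∑ a, g k t a := fun g => Finset.sum_comm
  have hXs : ∑ k, X k ≤ c1 * (K * (n * P)) := by
    calc ∑ k, X k ≤ ∑ t, c1 * ∑ k, ∑ a, x k t a ^ 2 := by
          rw [hX, comm]
          exact Finset.sum_le_sum fun t _ => hop_le _
      _ = c1 * ∑ k, ∑ t, ∑ a, x k t a ^ 2 := by rw [← Finset.mul_sum, comm fun k t a => x k t a ^ 2]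
      _ ≤ c1 * ∑ _k : Fin K, (n * P : ℝ) := by
          gcongr with k
          exact hx k
      _ = _ := by simp
  have hWs : ∑ k, W k ≤ c2 * energy z := by
    calc ∑ k, W k ≤ ∑ t, c2 * ∑ k, ∑ a, z k t a ^ 2 := by
          rw [hW, comm]
          exact Finset.sum_le_sum fun t _ => N_le _
      _ = _ := by rw [← Finset.mul_sum, energy, comm fun k t a => z k t a ^ 2]
  have hZs : ∑ k, Z k = energy z := rfl
  have hE : 0 ≤ energy z := hZs ▸ Finset.sum_nonneg fun k _ => Z0 k
  refine (Finset.sum_le_sum fun k _ => key k).trans ?_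
  rw [Finset.sum_add_distrib, Finset.sum_add_distrib, ← Finset.mul_sum, ← Finset.mul_sum,
    ← Finset.mul_sum, hZs]
  have : 2 * P⁻¹ * ∑ k, X k ≤ 2 * c1 * K * n := by
    calc 2 * P⁻¹ * ∑ k, X k ≤ 2 * P⁻¹ * (c1 * (K * (n * P))) := by gcongr
      _ = _ := by field_simp
  have : 0 ≤ c1 * K * energy z := by positivity
  have : 0 ≤ c2 * n := by positivity
  have : (0 : ℝ) ≤ n := by positivity
  nlinarith

/-- **Volume bound.** The success sets `S m` are mapped by the genie's view to disjoint sets, so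
that their Gaussian masses sum up to at most the mass of the whole space under a Gaussian profile
of variance of order `P` in the cells of `A` and of order `1` elsewhere. -/
theorem exists_sum_noise_le {L K : ℕ} {H : Fin K → Fin K → Matrix (Fin L) (Fin L) ℝ}
    {A C : Finset (Fin K)} (hAC : Determines H A C) :
    ∃ c : ℝ, 0 < c ∧ ∀ (n : ℕ) (P : ℝ), 1 ≤ P → ∀ (ι : Type) [Fintype ι]
      (x : ι → Fin K → Block L n) (S : ι → Set (Fin K → Block L n)),
      (∀ m, MeasurableSet (S m)) →
      (∀ m k, ∑ t, ∑ a, x m k t a ^ 2 ≤ n * P) →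
      (∀ m m', ∀ z ∈ S m, ∀ z' ∈ S m', (∀ k ∈ A, channel H (x m) z k = channel H (x m') z' k) →
        ∀ k ∈ C, x m k = x m' k) →
      (∀ m m', ∀ z ∈ S m, ∀ z' ∈ S m', channel H (x m) z = channel H (x m') z' → m = m') →
      ∑ m, noise L K n (S m) ≤ ENNReal.ofReal (c ^ n * √P ^ (A.card * L * n)) := by
  obtain ⟨N, h1, h2, h3⟩ := hAC.exists_linearMap
  obtain ⟨c, hc, hle⟩ := exists_weighted_genieView_le H A h1
  refine ⟨Real.exp (1 / 2) * √(2 * c * Real.pi) ^ (K * L), by positivity,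
    fun n P hP ι _ x S hS hx hC hdec => ?_⟩
  have hP0 : 0 < P := by linarith
  set b : Fin K → ℝ := fun k => (if k ∈ A then P⁻¹ else 1) / (2 * c) with hb
  have hb0 : ∀ k, 0 < b k := by
    intro k
    simp only [hb]
    split_ifs <;> positivity
  set F : (Fin K → Block L n) → ℝ≥0∞ := fun w =>
    ENNReal.ofReal (Real.exp (n / 2)) *
      ENNReal.ofReal (Real.exp (-∑ k, b k * ∑ t, ∑ a, w k t a ^ 2)) with hF
  have hT : ∀ m, MeasurePreserving (genieView H A N (x m)) ∧
      MeasurableEmbedding (genieView H A N (x m)) := fun m => measurePreserving_one_sub_overTime_add n h1 h2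
    (fun k t => mask A (Fin L → ℝ) (hop H fun i => x m i t) k)
  have hpt : ∀ m z, ENNReal.ofReal (Real.exp (-(energy z / 2))) ≤ F (genieView H A N (x m) z) := by
    intro m z
    simp only [hF]
    rw [← ENNReal.ofReal_mul (Real.exp_nonneg _), ← Real.exp_add]
    refine ENNReal.ofReal_le_ofReal (Real.exp_le_exp.2 ?_)
    have h := hle n P hP (x m) z (hx m)
    have e : ∑ k, b k * ∑ t, ∑ a, genieView H A N (x m) z k t a ^ 2
        = (∑ k, (if k ∈ A then P⁻¹ else 1) * ∑ t, ∑ a, genieView H A N (x m) z k t a ^ 2)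
          / (2 * c) := by
      rw [Finset.sum_div]
      exact Finset.sum_congr rfl fun k _ => by simp only [hb]; ring
    have : ∑ k, b k * ∑ t, ∑ a, genieView H A N (x m) z k t a ^ 2 ≤ (n + energy z) / 2 := by
      rw [e, div_le_iff₀ (by positivity)]
      linarith
    linarith
  have hdisj : Pairwise (Function.onFun Disjoint fun m => genieView H A N (x m) '' S m) := by
    intro m m' hmm
    refine Set.disjoint_left.2 ?_
    rintro w ⟨z, hz, rfl⟩ ⟨z', hz', h⟩
    refine hmm (hdec m m' z hz z' hz' ?_)
    refine channel_eq_of_genieView_eq h1 h2 h3 (hC m m' z hz z' hz' fun k hk => ?_) h.symm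
    rw [← genieView_of_mem h1 (x m) z hk, ← h, genieView_of_mem h1 (x m') z' hk]
  calc ∑ m, noise L K n (S m) ≤ ∑ m, ∫⁻ z in S m, F (genieView H A N (x m) z) :=
        Finset.sum_le_sum fun m _ => (noise_apply_le (hS m)).trans (lintegral_mono (hpt m))
    _ = ∑ m, ∫⁻ w in genieView H A N (x m) '' S m, F w :=
        Finset.sum_congr rfl fun m _ => (hT m).1.setLIntegral_comp_emb (hT m).2 F (S m)
    _ = ∫⁻ w in ⋃ m, genieView H A N (x m) '' S m, F w := by
        rw [lintegral_iUnion (fun m => (hT m).2.measurableSet_image.2 (hS m)) hdisj, tsum_fintype]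
    _ ≤ ∫⁻ w, F w := setLIntegral_le_lintegral _ _
    _ = ENNReal.ofReal (Real.exp (n / 2)) *
          ENNReal.ofReal (∏ k, √(Real.pi / b k) ^ (L * n)) := by
        rw [hF, lintegral_const_mul' _ _ ENNReal.ofReal_ne_top, lintegral_exp_neg_weighted _ _ _ _ hb0]
    _ = _ := by
        rw [← ENNReal.ofReal_mul (Real.exp_nonneg _)]
        congr 1
        have e : ∀ k, √(Real.pi / b k) ^ (L * n)
            = √(2 * c * Real.pi) ^ (L * n) * if k ∈ A then √P ^ (L * n) else 1 := by
          intro k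
          by_cases hk : k ∈ A
          · have : Real.pi / b k = (2 * c * Real.pi) * P := by
              simp only [hb, if_pos hk]
              field_simp
            rw [this, Real.sqrt_mul (by positivity), mul_pow, if_pos hk]
          · have : Real.pi / b k = 2 * c * Real.pi := by
              simp only [hb, if_neg hk]
              field_simp
            rw [this, if_neg hk, mul_one]
        have e2 : Real.exp ((n : ℝ) / 2) = Real.exp (1 / 2) ^ n := by
          rw [← Real.exp_nat_mul]
          ring_nf
        rw [Finset.prod_congr rfl fun k _ => e k, Finset.prod_mul_distrib, Finset.prod_const,
          Finset.prod_ite_mem, Finset.univ_inter, Finset.prod_const, Finset.card_univ,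
          Fintype.card_fin, e2, mul_pow, ← pow_mul, ← pow_mul, ← pow_mul]
        ring

/-! ### Locality and measurability of conferences -/

lemma mem_neighbours {K : ℕ} {k l : Fin K} :
    l ∈ neighbours k ↔ l.val + 1 = k.val ∨ k.val + 1 = l.val := by
  simp [neighbours]

/-- A message sent in round `j` (counted from `0`) depends only on the local data of the terminals
at distance at most `j` from its sender. -/
lemma conference_congr {K : ℕ} {S : Fin K → Type}
    (φ : (j : ℕ) → (k l : Fin K) → S k → Received k j → ℕ) (s s' : (k : Fin K) → S k)
    (j : ℕ) (k l : Fin K)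
    (h : ∀ i : Fin K, i.val ≤ k.val + j → k.val ≤ i.val + j → s i = s' i) :
    conference φ s j k l = conference φ s' j k l := by
  induction j using Nat.strong_induction_on generalizing k l with
  | _ j ih =>
    have hr : (fun (l' : {l // l ∈ neighbours k}) (i : Fin j) => conference φ s i.val l'.val k)
        = fun l' i => conference φ s' i.val l'.val k := by
      funext l' i
      refine ih i.val i.isLt l'.val k fun i' h1 h2 => ?_
      have hl := mem_neighbours.1 l'.2
      have := i.isLt
      exact h i' (by omega) (by omega)
    rw [conference, conference, h k (by omega) (by omega), hr]

/-- What is received during `r` rounds depends only on the terminals at distance at most `r`. -/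
lemma received_congr {K : ℕ} {S : Fin K → Type}
    (φ : (j : ℕ) → (k l : Fin K) → S k → Received k j → ℕ) (s s' : (k : Fin K) → S k)
    (r : ℕ) (k : Fin K)
    (h : ∀ i : Fin K, i.val ≤ k.val + r → k.val ≤ i.val + r → s i = s' i) :
    received φ s r k = received φ s' r k := by
  funext l' i
  refine conference_congr φ s s' i.val l'.val k fun i' h1 h2 => ?_
  have hl := mem_neighbours.1 l'.2
  have := i.isLt
  exact h i' (by omega) (by omega)

lemma measurable_conference {K : ℕ} {S : Fin K → Type} [∀ k, MeasurableSpace (S k)]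
    {φ : (j : ℕ) → (k l : Fin K) → S k → Received k j → ℕ}
    (hφ : ∀ j k l, Measurable (Function.uncurry (φ j k l))) {Z : Type*} [MeasurableSpace Z]
    {s : Z → (k : Fin K) → S k} (hs : ∀ k, Measurable fun z => s z k) (j : ℕ) (k l : Fin K) :
    Measurable fun z => conference φ (s z) j k l := by
  induction j using Nat.strong_induction_on generalizing k l with
  | _ j ih =>
    have e : (fun z => conference φ (s z) j k l) = fun z => Function.uncurry (φ j k l)
        (s z k, fun (l' : {l // l ∈ neighbours k}) (i : Fin j) =>
          conference φ (s z) i.val l'.val k) := by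
      funext z
      rw [conference]
      rfl
    rw [e]
    exact (hφ j k l).comp ((hs k).prodMk (measurable_pi_lambda _ fun l' =>
      measurable_pi_lambda _ fun i => ih i.val i.isLt l'.val k))

lemma measurable_received {K : ℕ} {S : Fin K → Type} [∀ k, MeasurableSpace (S k)]
    {φ : (j : ℕ) → (k l : Fin K) → S k → Received k j → ℕ}
    (hφ : ∀ j k l, Measurable (Function.uncurry (φ j k l))) {Z : Type*} [MeasurableSpace Z]
    {s : Z → (k : Fin K) → S k} (hs : ∀ k, Measurable fun z => s z k) (r : ℕ) (k : Fin K) :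
    Measurable fun z => received φ (s z) r k :=
  measurable_pi_lambda _ fun l' => measurable_pi_lambda _ fun i =>
    measurable_conference hφ hs i.val l'.val k

/-! ### Success sets of a code -/

namespace Code

variable {L K n D : ℕ} {mF mS : Fin K → ℕ} (c : Code L K n D mF mS)
  (H : Fin K → Fin K → Matrix (Fin L) (Fin L) ℝ)

/-- The noise realizations for which all decoders are correct when the messages are `m`. -/
def success (m : Messages mF mS) : Set (Fin K → Block L n) := {z | (m, z) ∉ c.errorEvent H}

lemma mem_success {m : Messages mF mS} {z : Fin K → Block L n} :
    z ∈ c.success H m ↔ ∀ k, c.decodeFast k (channel H (c.input m) z k) = m.1 k ∧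
      c.decodeSlow k (channel H (c.input m) z k)
        (received c.rxConf (channel H (c.input m) z) c.DRx k) = m.2 k := by
  have e : c.output H (m, z) = channel H (c.input m) z := rfl
  simp [success, errorEvent, e]

lemma measurableSet_success (m : Messages mF mS) : MeasurableSet (c.success H m) := by
  have hch : ∀ k, Measurable fun z : Fin K → Block L n => channel H (c.input m) z k := by
    intro k
    refine measurable_pi_lambda _ fun t => ?_
    simp only [channel]
    fun_prop
  have e : c.success H m = ⋂ k, ({z | c.decodeFast k (channel H (c.input m) z k) = m.1 k} ∩
      {z | Function.uncurry (c.decodeSlow k) (channel H (c.input m) z k,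
        received c.rxConf (channel H (c.input m) z) c.DRx k) = m.2 k}) := by
    ext z
    simp only [mem_success, Set.mem_iInter, Set.mem_inter_iff, Set.mem_ofPred_eq,
      Function.uncurry_apply_pair]
  rw [e]
  refine MeasurableSet.iInter fun k => MeasurableSet.inter ?_ ?_
  · exact ((c.measurable_decodeFast k).comp (hch k)) (measurableSet_singleton (m.1 k))
  · exact ((c.measurable_decodeSlow k).comp ((hch k).prodMk
      (measurable_received c.measurable_rxConf hch c.DRx k))) (measurableSet_singleton (m.2 k))

/-- If at least half of the probability is on correct decoding, then the masses of the success
sets add up to at least half of the number of message tuples. -/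
lemma card_le_two_mul_sum_noise [Nonempty (Messages mF mS)] (h : c.errorProb H ≤ 1 / 2) :
    (Fintype.card (Messages mF mS) : ℝ≥0∞) ≤ 2 * ∑ m, noise L K n (c.success H m) := by
  have hms : MeasurableSet (c.errorEvent H)ᶜ := by
    have e : (c.errorEvent H)ᶜ = ⋃ m, {m} ×ˢ c.success H m := by
      ext ⟨m, z⟩
      simp [success]
    rw [e]
    exact MeasurableSet.iUnion fun m =>
      (measurableSet_singleton m).prod (c.measurableSet_success H m)
  have hprob : IsProbabilityMeasure (uniformOn (Set.univ : Set (Messages mF mS))) :=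
    isProbabilityMeasure_uniformOn Set.finite_univ Set.univ_nonempty
  have hprob' : IsProbabilityMeasure (noise L K n) := by
    unfold noise
    infer_instance
  have hlaw : law L K n mF mS
      = (uniformOn (Set.univ : Set (Messages mF mS))).prod (noise L K n) := rfl
  have hlp : IsProbabilityMeasure (law L K n mF mS) := by
    rw [hlaw]
    infer_instance
  have h1 : (2 : ℝ≥0∞)⁻¹ ≤ law L K n mF mS (c.errorEvent H)ᶜ := by
    have hc := measureReal_compl (μ := law L K n mF mS) hms.of_compl
    rw [probReal_univ] at hc
    have h2 : (1 / 2 : ℝ) ≤ (law L K n mF mS).real (c.errorEvent H)ᶜ := by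
      rw [hc]
      change 1 / 2 ≤ 1 - c.errorProb H
      linarith
    rw [← ofReal_measureReal]
    refine le_trans (le_of_eq ?_) (ENNReal.ofReal_le_ofReal h2)
    rw [one_div, ENNReal.ofReal_inv_of_pos two_pos, ENNReal.ofReal_ofNat]
  have h2 : law L K n mF mS (c.errorEvent H)ᶜ
      = (Fintype.card (Messages mF mS) : ℝ≥0∞)⁻¹ * ∑ m, noise L K n (c.success H m) := by
    rw [hlaw, Measure.prod_apply hms, uniformOn, ProbabilityTheory.cond,
      Measure.restrict_univ, lintegral_smul_measure,
      lintegral_count, tsum_fintype, Measure.count_univ, smul_eq_mul]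
    simp only [ENat.card_eq_coe_fintype_card]
    rfl
  rw [h2] at h1
  have hcard : (Fintype.card (Messages mF mS) : ℝ≥0∞) ≠ 0 := by
    exact_mod_cast (Fintype.card_ne_zero : Fintype.card (Messages mF mS) ≠ 0)
  have h3 := mul_le_mul_right h1 (2 * (Fintype.card (Messages mF mS) : ℝ≥0∞))
  calc (Fintype.card (Messages mF mS) : ℝ≥0∞)
      = 2 * (Fintype.card (Messages mF mS) : ℝ≥0∞) * 2⁻¹ := by
        rw [mul_comm 2, mul_assoc, ENNReal.mul_inv_cancel two_ne_zero ENNReal.ofNat_ne_top, mul_one]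
    _ ≤ _ := h3
    _ = _ := by
        rw [mul_assoc, ← mul_assoc (Fintype.card (Messages mF mS) : ℝ≥0∞),
          ENNReal.mul_inv_cancel hcard (ENNReal.natCast_ne_top _), one_mul]

lemma fast_eq_of_channel_eq {m m' : Messages mF mS} {z z' : Fin K → Block L n}
    (hz : z ∈ c.success H m) (hz' : z' ∈ c.success H m') {k : Fin K}
    (h : channel H (c.input m) z k = channel H (c.input m') z' k) : m.1 k = m'.1 k := by
  rw [← (((c.mem_success H).1 hz) k).1, ← (((c.mem_success H).1 hz') k).1, h]

lemma slow_eq_of_channel_eq {m m' : Messages mF mS} {z z' : Fin K → Block L n}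
    (hz : z ∈ c.success H m) (hz' : z' ∈ c.success H m') {k : Fin K}
    (h : ∀ i : Fin K, i.val ≤ k.val + c.DRx → k.val ≤ i.val + c.DRx →
      channel H (c.input m) z i = channel H (c.input m') z' i) : m.2 k = m'.2 k := by
  rw [← (((c.mem_success H).1 hz) k).2, ← (((c.mem_success H).1 hz') k).2,
    received_congr c.rxConf _ _ c.DRx k h, h k (by omega) (by omega)]

lemma input_congr {m m' : Messages mF mS} {k : Fin K} (h1 : m.1 k = m'.1 k)
    (h2 : ∀ i : Fin K, i.val ≤ k.val + c.DTx → k.val ≤ i.val + c.DTx → m.2 i = m'.2 i) :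
    c.input m k = c.input m' k := by
  rw [input, input, h1, h2 k (by omega) (by omega), received_congr c.txConf _ _ c.DTx k h2]

lemma messages_eq_of_channel_eq {m m' : Messages mF mS} {z z' : Fin K → Block L n}
    (hz : z ∈ c.success H m) (hz' : z' ∈ c.success H m')
    (h : channel H (c.input m) z = channel H (c.input m') z') : m = m' :=
  Prod.ext (funext fun k => c.fast_eq_of_channel_eq H hz hz' (congrFun h k))
    (funext fun _ => c.slow_eq_of_channel_eq H hz hz' fun i _ _ => congrFun h i)

/-- The outputs at distance at most `D` from `k` determine the input of Tx `k`: they suffice for the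
slow messages at distance at most `DTx`, and only these reach Tx `k` in the Tx-conference. -/
lemma input_eq_of_channel_eq {m m' : Messages mF mS} {z z' : Fin K → Block L n}
    (hz : z ∈ c.success H m) (hz' : z' ∈ c.success H m') {k : Fin K}
    (h : ∀ i : Fin K, i.val ≤ k.val + D → k.val ≤ i.val + D →
      channel H (c.input m) z i = channel H (c.input m') z' i) : c.input m k = c.input m' k := by
  have := c.delay
  refine c.input_congr (c.fast_eq_of_channel_eq H hz hz' (h k (by omega) (by omega)))
    fun l h1 h2 => c.slow_eq_of_channel_eq H hz hz' fun i h3 h4 => h i (by omega) (by omega)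

lemma power_le {μTx μRx : ℝ≥0} {P : ℝ} (hn : 1 ≤ n) (hc : c.Admissible H μTx μRx P)
    (m : Messages mF mS) (k : Fin K) : ∑ t, ∑ a, c.input m k t a ^ 2 ≤ n * P := by
  have hn0 : (0 : ℝ) < n := by exact_mod_cast hn
  have h := hc.power m k
  rwa [one_div, inv_mul_le_iff₀ hn0] at h

end Code

/-- Bound on the number of all messages, for receivers `A` whose outputs determine, within distance
`D`, the inputs in `C`. -/
lemma exists_card_messages_le {L K D : ℕ} {H : Fin K → Fin K → Matrix (Fin L) (Fin L) ℝ}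
    {A C : Finset (Fin K)} (hAC : Determines H A C)
    (hC : ∀ k ∈ C, ∀ i : Fin K, i.val ≤ k.val + D → k.val ≤ i.val + D → i ∈ A) :
    ∃ b : ℝ, 0 < b ∧ ∀ (n : ℕ) (P : ℝ) (μTx μRx : ℝ≥0) (mF mS : Fin K → ℕ)
      (c : Code L K n D mF mS), 1 ≤ n → 1 ≤ P → Nonempty (Messages mF mS) →
      c.Admissible H μTx μRx P → c.errorProb H ≤ 1 / 2 →
      (∏ k, (mF k : ℝ)) * ∏ k, (mS k : ℝ) ≤ 2 * (b ^ n * √P ^ (A.card * L * n)) := by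
  obtain ⟨b, hb, hle⟩ := exists_sum_noise_le hAC
  refine ⟨b, hb, fun n P μTx μRx mF mS c hn hP hne hadm herr => ?_⟩
  have h1 := c.card_le_two_mul_sum_noise H herr
  have h2 := hle n P hP (Messages mF mS) c.input (c.success H) (c.measurableSet_success H)
    (c.power_le H hn hadm)
    (fun m m' z hz z' hz' h k hk => c.input_eq_of_channel_eq H hz hz'
      fun i h1 h2 => h i (hC k hk i h1 h2))
    (fun m m' z hz z' hz' h => c.messages_eq_of_channel_eq H hz hz' h)
  have h3 := h1.trans (mul_le_mul_right h2 2)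
  rw [← ENNReal.ofReal_ofNat, ← ENNReal.ofReal_mul zero_le_two, ← ENNReal.ofReal_natCast,
    ENNReal.ofReal_le_ofReal_iff (by positivity)] at h3
  simpa [Fintype.card_prod, Fintype.card_pi] using h3

/-- Bound on the number of fast messages: for fixed slow messages, each input depends on one fast
message only, which its own receiver decodes without cooperation. -/
lemma exists_card_fast_le {L K D : ℕ} {H : Fin K → Fin K → Matrix (Fin L) (Fin L) ℝ}
    {A : Finset (Fin K)} (hA : Determines H A A) :
    ∃ b : ℝ, 0 < b ∧ ∀ (n : ℕ) (P : ℝ) (μTx μRx : ℝ≥0) (mF mS : Fin K → ℕ)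
      (c : Code L K n D mF mS), 1 ≤ n → 1 ≤ P → Nonempty (Messages mF mS) →
      c.Admissible H μTx μRx P → c.errorProb H ≤ 1 / 2 →
      ∏ k, (mF k : ℝ) ≤ 2 * (b ^ n * √P ^ (A.card * L * n)) := by
  obtain ⟨b, hb, hle⟩ := exists_sum_noise_le hA
  refine ⟨b, hb, fun n P μTx μRx mF mS c hn hP hne hadm herr => ?_⟩
  have h1 := c.card_le_two_mul_sum_noise H herr
  have h2 : ∀ s : (k : Fin K) → Fin (mS k),
      ∑ m : (k : Fin K) → Fin (mF k), noise L K n (c.success H (m, s))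
        ≤ ENNReal.ofReal (b ^ n * √P ^ (A.card * L * n)) := fun s =>
    hle n P hP ((k : Fin K) → Fin (mF k)) (fun m => c.input (m, s)) (fun m => c.success H (m, s))
      (fun m => c.measurableSet_success H (m, s)) (fun m => c.power_le H hn hadm (m, s))
      (fun m m' z hz z' hz' h _ hk =>
        c.input_congr (c.fast_eq_of_channel_eq H hz hz' (h _ hk)) fun _ _ _ => rfl)
      (fun m m' z hz z' hz' h => congrArg Prod.fst (c.messages_eq_of_channel_eq H hz hz' h))
  have h3 : ∑ m, noise L K n (c.success H m) ≤ (∏ k, mS k : ℕ) *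
      ENNReal.ofReal (b ^ n * √P ^ (A.card * L * n)) := by
    rw [Fintype.sum_prod_type_right]
    refine (Finset.sum_le_sum fun s _ => h2 s).trans (le_of_eq ?_)
    simp [Fintype.card_pi]
  have h4 := h1.trans (mul_le_mul_right h3 2)
  rw [← ENNReal.ofReal_ofNat, ← ENNReal.ofReal_natCast, ← ENNReal.ofReal_natCast,
    ← ENNReal.ofReal_mul (by positivity), ← ENNReal.ofReal_mul zero_le_two,
    ENNReal.ofReal_le_ofReal_iff (by positivity), Fintype.card_prod, Fintype.card_pi,
    Fintype.card_pi] at h4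
  simp only [Fintype.card_fin] at h4
  have hS : (0 : ℝ) < (∏ k, mS k : ℕ) := by
    obtain ⟨m⟩ := hne
    have : 0 < ∏ k, mS k := Finset.prod_pos fun k _ => Fin.pos (m.2 k)
    exact_mod_cast this
  have h5 : ((∏ k, mS k : ℕ) : ℝ) * ∏ k, (mF k : ℝ)
      ≤ (∏ k, mS k : ℕ) * (2 * (b ^ n * √P ^ (A.card * L * n))) := by
    refine le_trans (le_of_eq ?_) (h4.trans (le_of_eq ?_))
    · push_cast; ring
    · ring
  exact le_of_mul_le_mul_left h5 hS

/-! ### From message counts to multiplexing gains -/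

/-- Rounding down the number of messages costs at most a factor of `2`. -/
lemma two_rpow_le_two_mul_numMessages {n : ℕ} {R : ℝ} (hR : 0 ≤ R) :
    (2 : ℝ) ^ ((n : ℝ) * R) ≤ 2 * (numMessages n R : ℝ) := by
  have h1 : (1 : ℝ) ≤ (2 : ℝ) ^ ((n : ℝ) * R) :=
    Real.one_le_rpow one_le_two (by positivity)
  have h2 : (1 : ℝ) ≤ numMessages n R := by
    exact_mod_cast (Nat.one_le_floor_iff _).2 h1
  have h3 := Nat.lt_floor_add_one ((2 : ℝ) ^ ((n : ℝ) * R))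
  change _ < (numMessages n R : ℝ) + 1 at h3
  linarith

lemma numMessages_pos {n : ℕ} {R : ℝ} (hR : 0 ≤ R) : 0 < numMessages n R :=
  Nat.floor_pos.2 (Real.one_le_rpow one_le_two (by positivity))

/-- A bound on the number of messages for all large `n` bounds the sum of the rates: constant
factors vanish in the limit of large blocklength. -/
lemma sum_rates_le {J : Type*} [Fintype J] {R : J → ℝ} (hR : ∀ k, 0 ≤ R k) {b P : ℝ} {q : ℕ}
    (hb : 0 < b) (hP : 0 < P)
    (h : ∀ᶠ n : ℕ in atTop, ∏ k, (numMessages n (R k) : ℝ) ≤ 2 * (b ^ n * √P ^ (q * n))) :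
    ∑ k, R k ≤ Real.logb 2 b + q * (1 / 2 * Real.logb 2 P) := by
  by_contra! hlt
  set δ := ∑ k, R k - (Real.logb 2 b + q * (1 / 2 * Real.logb 2 P)) with hδ
  have hδ0 : 0 < δ := by rw [hδ]; linarith
  obtain ⟨n₀, hn₀⟩ := exists_nat_gt (((Fintype.card J : ℝ) + 1) / δ)
  obtain ⟨n, hn, hle⟩ := ((eventually_ge_atTop n₀).and h).exists
  have hn' : ((Fintype.card J : ℝ) + 1) < n * δ := by
    rw [← div_lt_iff₀ hδ0]
    exact hn₀.trans_le (by exact_mod_cast hn)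
  have h1 : (2 : ℝ) ^ ((n : ℝ) * ∑ k, R k)
      ≤ 2 ^ Fintype.card J * (2 * (b ^ n * √P ^ (q * n))) := by
    calc (2 : ℝ) ^ ((n : ℝ) * ∑ k, R k) = ∏ k, (2 : ℝ) ^ ((n : ℝ) * R k) := by
          rw [Finset.mul_sum, Real.rpow_sum_of_pos two_pos]
      _ ≤ ∏ k, (2 * (numMessages n (R k) : ℝ)) :=
          Finset.prod_le_prod (fun _ _ => by positivity)
            fun k _ => two_rpow_le_two_mul_numMessages (hR k)
      _ = 2 ^ Fintype.card J * ∏ k, (numMessages n (R k) : ℝ) := by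
          rw [Finset.prod_mul_distrib, Finset.prod_const, Finset.card_univ]
      _ ≤ _ := by gcongr
  have hsP : 0 < √P := Real.sqrt_pos.2 hP
  have h2 := Real.logb_le_logb_of_le one_lt_two (by positivity) h1
  rw [Real.logb_rpow two_pos (by norm_num), Real.logb_mul (by positivity) (by positivity),
    Real.logb_mul (by positivity) (by positivity), Real.logb_mul (by positivity) (by positivity),
    Real.logb_pow, Real.logb_pow, Real.logb_pow, Real.logb_self_eq_one one_lt_two,
    Real.sqrt_eq_rpow, Real.logb_rpow_eq_mul_logb_of_pos hP] at h2
  push_cast at h2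
  have : (n : ℝ) * δ = n * ∑ k, R k
      - (n * Real.logb 2 b + q * n * (1 / 2 * Real.logb 2 P)) := by
    rw [hδ]; ring
  linarith

/-- A bound on the sum-rate whose prelog is at most `α K + β` bounds the multiplexing gain
by `α`. -/
lemma limit_le_of_prelog_le {r : ℕ → ℝ → ℝ} {q c : ℕ → ℝ} {α β : ℝ}
    (h : ∀ K, 1 ≤ K → ∀ P, 1 < P → K * r K P ≤ c K + q K * (1 / 2 * Real.logb 2 P))
    (hq : ∀ K, q K ≤ α * K + β) {K : ℕ → ℕ} {P : ℕ → ℕ → ℝ} {s : ℕ → ℝ} {S : ℝ}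
    (hK : Tendsto K atTop atTop) (hP : ∀ i, Tendsto (P i) atTop atTop)
    (hs : ∀ i, Tendsto (fun j => r (K i) (P i j) / (1 / 2 * Real.logb 2 (P i j))) atTop (𝓝 (s i)))
    (hS : Tendsto s atTop (𝓝 S)) : S ≤ α := by
  have h1 : ∀ i, 1 ≤ K i → s i ≤ α + β / K i := by
    intro i hi
    have hK0 : (0 : ℝ) < K i := by exact_mod_cast hi
    have hlog : Tendsto (fun j => 1 / 2 * Real.logb 2 (P i j)) atTop atTop :=
      ((Real.tendsto_logb_atTop one_lt_two).comp (hP i)).const_mul_atTop (by norm_num)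
    have hlim : Tendsto (fun j => (c (K i) / (1 / 2 * Real.logb 2 (P i j)) + q (K i)) / K i)
        atTop (𝓝 ((0 + q (K i)) / K i)) :=
      ((hlog.const_div_atTop _).add_const _).div_const _
    have h2 : s i ≤ (0 + q (K i)) / K i := by
      refine le_of_tendsto_of_tendsto (hs i) hlim ?_
      filter_upwards [hlog.eventually_gt_atTop 0, (hP i).eventually_gt_atTop 1] with j hj hPj
      have h3 := h (K i) hi (P i j) hPj
      rw [le_div_iff₀ hK0, div_mul_eq_mul_div, div_le_iff₀ hj, add_mul, div_mul_cancel₀ _ hj.ne']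
      linarith
    refine h2.trans ?_
    rw [zero_add, div_le_iff₀ hK0, add_mul, div_mul_cancel₀ _ hK0.ne']
    exact hq _
  have hlim : Tendsto (fun i => α + β / (K i : ℝ)) atTop (𝓝 (α + 0)) :=
    ((tendsto_natCast_atTop_atTop.comp hK).const_div_atTop β).const_add α
  rw [add_zero] at hlim
  refine le_of_tendsto_of_tendsto hS hlim ?_
  filter_upwards [hK.eventually_ge_atTop 1] with i hi using h1 i hi

/-! ### Which receivers determine the network -/

lemma mulVec_injective_of_rank_eq {L : ℕ} {M : Matrix (Fin L) (Fin L) ℝ} (h : M.rank = L) :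
    Function.Injective M.mulVec := by
  have hs : Function.Surjective M.mulVecLin := by
    rw [← LinearMap.range_eq_top]
    refine Submodule.eq_top_of_finrank_eq ?_
    rw [Module.finrank_fin_fun]
    exact h
  exact LinearMap.injective_iff_surjective.2 hs

/-- A receiver with a known input of its own and of one neighbour determines the input of the other
neighbour. -/
lemma eq_zero_of_hop_eq_zero {L K : ℕ} {H : Fin K → Fin K → Matrix (Fin L) (Fin L) ℝ}
    {v : Fin K → Fin L → ℝ} {i k : Fin K} (hH : (H i k).rank = L) (hi : i ∈ neighbours k)
    (hv : hop H v k = 0) (hk : v k = 0) (hn : ∀ j ∈ neighbours k, j ≠ i → v j = 0) : v i = 0 := by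
  refine mulVec_injective_of_rank_eq hH ?_
  have hv' : (H k k).mulVec (v k) + ∑ i ∈ neighbours k, (H i k).mulVec (v i) = 0 := hv
  rw [Finset.sum_eq_single_of_mem i hi fun j hj hji => by rw [hn j hj hji, Matrix.mulVec_zero], hk,
    Matrix.mulVec_zero, zero_add] at hv'
  rw [hv', Matrix.mulVec_zero]

/-- The cells with even index. -/
def evenCells (K : ℕ) : Finset (Fin K) := Finset.univ.filter fun k => k.val % 2 = 0

/-- From left to right, the output of an even cell gives the input of its right neighbour. -/
lemma determines_evenCells {L K : ℕ} {H : Fin K → Fin K → Matrix (Fin L) (Fin L) ℝ}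
    (hH : ∀ k, ∀ i ∈ neighbours k, (H i k).rank = L) :
    Determines H (evenCells K) (evenCells K) := by
  intro v hv hhop
  have key : ∀ m (hm : m < K), v ⟨m, hm⟩ = 0 := by
    intro m
    induction m using Nat.strong_induction_on with
    | _ m ih =>
      intro hm
      by_cases hpar : m % 2 = 0
      · exact hv _ (by simpa [evenCells] using hpar)
      · have hA : (⟨m - 1, by omega⟩ : Fin K) ∈ evenCells K := by
          simp only [evenCells, Finset.mem_filter, Finset.mem_univ, true_and]
          omega
        have hn : (⟨m, hm⟩ : Fin K) ∈ neighbours (⟨m - 1, by omega⟩ : Fin K) :=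
          mem_neighbours.2 (Or.inr (by simp only; omega))
        refine eq_zero_of_hop_eq_zero (hH _ _ hn) hn (hhop _ hA) (hv _ hA) fun j hj hji => ?_
        have hj' := mem_neighbours.1 hj
        have : j.val ≠ m := fun h => hji (Fin.ext h)
        simp only at hj'
        exact ih j.val (by omega) j.isLt
  exact funext fun k => key k.val k.isLt

lemma card_evenCells_le (K : ℕ) : ((evenCells K).card : ℝ) ≤ K / 2 + 1 := by
  have h : (evenCells K).card ≤ (Finset.range (K / 2 + 1)).card := by
    refine Finset.card_le_card_of_injOn (fun k => k.val / 2) (fun k _ => ?_) fun k hk l hl h => ?_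
    · have := k.isLt
      simp only [Finset.coe_range, Set.mem_Iio]
      omega
    · simp only [evenCells, Finset.coe_filter, Finset.mem_univ, true_and, Set.mem_ofPred_eq] at hk hl
      simp only at h
      exact Fin.ext (by omega)
  rw [Finset.card_range] at h
  calc ((evenCells K).card : ℝ) ≤ ((K / 2 + 1 : ℕ) : ℝ) := by exact_mod_cast h
    _ ≤ _ := by
      push_cast
      gcongr
      exact Nat.cast_div_le

/-- All cells but the first and the last one of each group of `2 D + 4` consecutive cells; the
exceptions are not made near the end of the network. -/
def groupCells (D K : ℕ) : Finset (Fin K) := Finset.univ.filter fun k =>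
  (1 ≤ k.val % (2 * D + 4) ∧ k.val % (2 * D + 4) ≤ 2 * D + 2) ∨ K ≤ k.val + 2 * (2 * D + 4)

/-- The two cells in the middle of each group of `2 D + 4` consecutive cells, and the cells at the
end of the network. -/
def middleCells (D K : ℕ) : Finset (Fin K) := Finset.univ.filter fun k =>
  (D + 1 ≤ k.val % (2 * D + 4) ∧ k.val % (2 * D + 4) ≤ D + 2) ∨ K ≤ k.val + (2 * D + 4)

lemma mem_groupCells_of_eq {D K q r : ℕ} {k : Fin K} (hk : k.val = (2 * D + 4) * q + r)
    (h1 : 1 ≤ r) (h2 : r ≤ 2 * D + 2) : k ∈ groupCells D K := by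
  have : k.val % (2 * D + 4) = r := by
    rw [hk, Nat.mul_add_mod, Nat.mod_eq_of_lt (by omega)]
  simp only [groupCells, Finset.mem_filter, Finset.mem_univ, true_and, this]
  exact Or.inl ⟨h1, h2⟩

lemma mem_groupCells_of_near {D K : ℕ} {k i : Fin K} (hk : k ∈ middleCells D K)
    (h1 : i.val ≤ k.val + D) (h2 : k.val ≤ i.val + D) : i ∈ groupCells D K := by
  simp only [middleCells, Finset.mem_filter, Finset.mem_univ, true_and] at hk
  rcases hk with hk | hk
  · have hdiv := Nat.div_add_mod k.val (2 * D + 4)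
    refine mem_groupCells_of_eq (q := k.val / (2 * D + 4))
      (r := i.val - (2 * D + 4) * (k.val / (2 * D + 4))) ?_ ?_ ?_ <;> omega
  · simp only [groupCells, Finset.mem_filter, Finset.mem_univ, true_and]
    omega

/-- The inputs of a group are recovered from the middle outwards. -/
lemma determines_groupCells {L K : ℕ} (D : ℕ) {H : Fin K → Fin K → Matrix (Fin L) (Fin L) ℝ}
    (hH : ∀ k, ∀ i ∈ neighbours k, (H i k).rank = L) :
    Determines H (groupCells D K) (middleCells D K) := by
  intro v hv hhop
  have hmid : ∀ q r (hm : (2 * D + 4) * q + r < K), D + 1 ≤ r → r ≤ D + 2 →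
      v ⟨(2 * D + 4) * q + r, hm⟩ = 0 := by
    intro q r hm h1 h2
    refine hv _ ?_
    simp only [middleCells, Finset.mem_filter, Finset.mem_univ, true_and, Nat.mul_add_mod,
      Nat.mod_eq_of_lt (show r < 2 * D + 4 by omega)]
    exact Or.inl ⟨h1, h2⟩
  -- Going up, the receiver just below the unknown input is used.
  have hup : ∀ q r (hm : (2 * D + 4) * q + r < K), D + 1 ≤ r → r ≤ 2 * D + 3 →
      v ⟨(2 * D + 4) * q + r, hm⟩ = 0 := by
    intro q r
    induction r using Nat.strong_induction_on with
    | _ r ih =>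
      intro hm h1 h2
      by_cases hr : r ≤ D + 2
      · exact hmid q r hm h1 hr
      · have hn : (⟨(2 * D + 4) * q + r, hm⟩ : Fin K) ∈
            neighbours (⟨(2 * D + 4) * q + (r - 1), by omega⟩ : Fin K) :=
          mem_neighbours.2 (Or.inr (by simp only; omega))
        refine eq_zero_of_hop_eq_zero (hH _ _ hn) hn
          (hhop _ (mem_groupCells_of_eq rfl (by omega) (by omega)))
          (ih (r - 1) (by omega) (by omega) (by omega) (by omega)) fun j hj hji => ?_
        have hj' := mem_neighbours.1 hj
        have hne : j.val ≠ (2 * D + 4) * q + r := fun h => hji (Fin.ext h)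
        simp only at hj'
        have e : j = ⟨(2 * D + 4) * q + (r - 2), by omega⟩ := Fin.ext (by simp only; omega)
        rw [e]
        exact ih (r - 2) (by omega) (by omega) (by omega) (by omega)
  -- Going down, the receiver just above is used; it may be missing only where the inputs at the
  -- end of the network are known anyway.
  have hdown : ∀ q d r (hm : (2 * D + 4) * q + r < K), r + d = D + 2 →
      v ⟨(2 * D + 4) * q + r, hm⟩ = 0 := by
    intro q d
    induction d using Nat.strong_induction_on with
    | _ d ih =>
      intro r hm hd
      by_cases hr : d ≤ 1
      · exact hmid q r hm (by omega) (by omega)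
      by_cases hend : K ≤ (2 * D + 4) * q + r + (2 * D + 4)
      · refine hv _ ?_
        simp only [middleCells, Finset.mem_filter, Finset.mem_univ, true_and]
        exact Or.inr hend
      · have hn : (⟨(2 * D + 4) * q + r, hm⟩ : Fin K) ∈
            neighbours (⟨(2 * D + 4) * q + (r + 1), by omega⟩ : Fin K) :=
          mem_neighbours.2 (Or.inl (by simp only; omega))
        refine eq_zero_of_hop_eq_zero (hH _ _ hn) hn
          (hhop _ (mem_groupCells_of_eq rfl (by omega) (by omega)))
          (ih (d - 1) (by omega) (r + 1) (by omega) (by omega)) fun j hj hji => ?_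
        have hj' := mem_neighbours.1 hj
        have hne : j.val ≠ (2 * D + 4) * q + r := fun h => hji (Fin.ext h)
        simp only at hj'
        have e : j = ⟨(2 * D + 4) * q + (r + 2), by omega⟩ := Fin.ext (by simp only; omega)
        rw [e]
        exact ih (d - 2) (by omega) (r + 2) (by omega) (by omega)
  funext k
  have hdiv := Nat.div_add_mod k.val (2 * D + 4)
  have hlt := Nat.mod_lt k.val (show 0 < 2 * D + 4 by omega)
  have e : k = ⟨(2 * D + 4) * (k.val / (2 * D + 4)) + k.val % (2 * D + 4), by
    rw [hdiv]; exact k.isLt⟩ := Fin.ext hdiv.symm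
  rw [e]
  by_cases hr : k.val % (2 * D + 4) ≤ D + 2
  · exact hdown _ (D + 2 - k.val % (2 * D + 4)) _ _ (by omega)
  · exact hup _ _ _ (by omega) (by omega)

lemma card_groupCells_le (D K : ℕ) :
    ((groupCells D K).card : ℝ) ≤ ((D : ℝ) + 1) / (D + 2) * K + (6 * D + 10) := by
  have h1 : (Finset.univ.filter fun k : Fin K =>
      1 ≤ k.val % (2 * D + 4) ∧ k.val % (2 * D + 4) ≤ 2 * D + 2).card
      ≤ (Finset.range (K / (2 * D + 4) + 1) ×ˢ Finset.range (2 * D + 2)).card := by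
    refine Finset.card_le_card_of_injOn
      (fun k => (k.val / (2 * D + 4), k.val % (2 * D + 4) - 1)) (fun k hk => ?_)
      fun k hk l hl h => ?_
    · simp only [Finset.coe_filter, Finset.mem_univ, true_and, Set.mem_ofPred_eq] at hk
      have := Nat.div_le_div_right (c := 2 * D + 4) k.isLt.le
      simp only [Finset.coe_product, Finset.coe_range, Set.mem_prod, Set.mem_Iio]
      omega
    · simp only [Finset.coe_filter, Finset.mem_univ, true_and, Set.mem_ofPred_eq] at hk hl
      simp only [Prod.mk.injEq] at h
      refine Fin.ext ?_
      rw [← Nat.div_add_mod k.val (2 * D + 4), ← Nat.div_add_mod l.val (2 * D + 4), h.1]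
      omega
  have h2 : (Finset.univ.filter fun k : Fin K => K ≤ k.val + 2 * (2 * D + 4)).card
      ≤ (Finset.range (2 * (2 * D + 4))).card := by
    refine Finset.card_le_card_of_injOn (fun k => K - 1 - k.val) (fun k hk => ?_)
      fun k hk l hl h => ?_
    · simp only [Finset.coe_filter, Finset.mem_univ, true_and, Set.mem_ofPred_eq] at hk
      simp only [Finset.coe_range, Set.mem_Iio]
      omega
    · have := k.isLt
      have := l.isLt
      simp only at h
      exact Fin.ext (by omega)
  have h3 : (groupCells D K).card ≤ (K / (2 * D + 4) + 1) * (2 * D + 2) + 2 * (2 * D + 4) := by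
    rw [groupCells, Finset.filter_or]
    refine (Finset.card_union_le _ _).trans ?_
    rw [Finset.card_product, Finset.card_range, Finset.card_range] at h1
    rw [Finset.card_range] at h2
    omega
  have h4 : ((K / (2 * D + 4) : ℕ) : ℝ) ≤ (K : ℝ) / (2 * D + 4) := by
    refine Nat.cast_div_le.trans (le_of_eq ?_)
    push_cast
    rfl
  calc ((groupCells D K).card : ℝ)
      ≤ (((K / (2 * D + 4) : ℕ) : ℝ) + 1) * (2 * D + 2) + 2 * (2 * D + 4) := by exact_mod_cast h3
    _ ≤ ((K : ℝ) / (2 * D + 4) + 1) * (2 * D + 2) + 2 * (2 * D + 4) := by gcongr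
    _ = _ := by
      field_simp
      ring

/-! ### The bounds on the multiplexing gains -/

lemma nonempty_messages {K : ℕ} (n : ℕ) {RF RS : Fin K → ℝ} (hF : ∀ k, 0 ≤ RF k)
    (hS : ∀ k, 0 ≤ RS k) : Nonempty (Messages (fun k => numMessages n (RF k))
      (fun k => numMessages n (RS k))) :=
  ⟨(fun k => ⟨0, numMessages_pos (hF k)⟩, fun k => ⟨0, numMessages_pos (hS k)⟩)⟩

lemma exists_sum_rate_le {L K D : ℕ} {H : Fin K → Fin K → Matrix (Fin L) (Fin L) ℝ}
    {A C : Finset (Fin K)} (hK : 1 ≤ K) (hAC : Determines H A C)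
    (hC : ∀ k ∈ C, ∀ i : Fin K, i.val ≤ k.val + D → k.val ≤ i.val + D → i ∈ A) :
    ∃ b : ℝ, ∀ (μTx μRx : ℝ≥0) (P rF rS : ℝ), 1 < P → AchievableRates L D K μTx μRx H P rF rS →
      K * (rF + rS) ≤ b + (A.card * L : ℕ) * (1 / 2 * Real.logb 2 P) := by
  obtain ⟨b, hb, hle⟩ := exists_card_messages_le hAC hC
  refine ⟨Real.logb 2 b, fun μTx μRx P rF rS hP hach => ?_⟩
  obtain ⟨RF, RS, hRF, hRS, rfl, rfl, c, hadm, herr⟩ := hach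
  have hK0 : (K : ℝ) ≠ 0 := by positivity
  have h := sum_rates_le (J := Fin K ⊕ Fin K) (R := Sum.elim RF RS) (b := b) (P := P)
    (q := A.card * L) (by rintro (k | k); exacts [hRF k, hRS k]) hb (by linarith) ?_
  · rw [Fintype.sum_sum_type] at h
    simp only [Sum.elim_inl, Sum.elim_inr] at h
    rwa [← mul_add, ← mul_assoc, mul_one_div_cancel hK0, one_mul]
  · filter_upwards [eventually_ge_atTop 1, herr.eventually_le_const (show (0 : ℝ) < 1 / 2 by norm_num)]
      with n hn hen
    rw [Fintype.prod_sum_type]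
    exact hle n P μTx μRx _ _ (c n) hn hP.le (nonempty_messages n hRF hRS) (hadm n hn) hen

lemma exists_fast_rate_le {L K D : ℕ} {H : Fin K → Fin K → Matrix (Fin L) (Fin L) ℝ}
    {A : Finset (Fin K)} (hK : 1 ≤ K) (hA : Determines H A A) :
    ∃ b : ℝ, ∀ (μTx μRx : ℝ≥0) (P rF rS : ℝ), 1 < P → AchievableRates L D K μTx μRx H P rF rS →
      K * rF ≤ b + (A.card * L : ℕ) * (1 / 2 * Real.logb 2 P) := by
  obtain ⟨b, hb, hle⟩ := exists_card_fast_le (D := D) hA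
  refine ⟨Real.logb 2 b, fun μTx μRx P rF rS hP hach => ?_⟩
  obtain ⟨RF, RS, hRF, hRS, rfl, rfl, c, hadm, herr⟩ := hach
  have hK0 : (K : ℝ) ≠ 0 := by positivity
  have h := sum_rates_le (R := RF) (b := b) (P := P) (q := A.card * L) hRF hb (by linarith) ?_
  · rwa [← mul_assoc, mul_one_div_cancel hK0, one_mul]
  · filter_upwards [eventually_ge_atTop 1, herr.eventually_le_const (show (0 : ℝ) < 1 / 2 by norm_num)]
      with n hn hen
    exact hle n P μTx μRx _ _ (c n) hn hP.le (nonempty_messages n hRF hRS) (hadm n hn) hen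

end WynerSym

theorem proposition1 (L D : ℕ) (μTx μRx : ℝ≥0)
    (H : (K : ℕ) → Fin K → Fin K → Matrix (Fin L) (Fin L) ℝ)
    (hH : ∀ (K : ℕ) (i k : Fin K), i = k ∨ i ∈ WynerSym.neighbours k → (H K i k).rank = L)
    (S : ℝ × ℝ) (hS : S ∈ WynerSym.optimalMGRegion L D μTx μRx H) :
    S.1 ≤ (L : ℝ) / 2 ∧ S.1 + S.2 ≤ (L : ℝ) * (((D : ℝ) + 1) / ((D : ℝ) + 2)) := by
  have hH' : ∀ (K : ℕ) (k : Fin K), ∀ i ∈ WynerSym.neighbours k, (H K i k).rank = L :=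
    fun K k i hi => hH K i k (Or.inr hi)
  refine closure_minimal (t := {S : ℝ × ℝ | S.1 ≤ (L : ℝ) / 2 ∧
    S.1 + S.2 ≤ (L : ℝ) * (((D : ℝ) + 1) / ((D : ℝ) + 2))}) ?_ ?_ hS
  · rintro S ⟨rF, rS, hach, K, P, s, hK, hP, hs, hS⟩
    constructor
    · have h : ∀ K, ∃ b : ℝ, 1 ≤ K → ∀ P, 1 < P → K * rF K P
          ≤ b + ((WynerSym.evenCells K).card * L : ℕ) * (1 / 2 * Real.logb 2 P) := by
        intro K
        by_cases hK1 : 1 ≤ K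
        · obtain ⟨b, hb⟩ := WynerSym.exists_fast_rate_le (D := D) hK1
            (WynerSym.determines_evenCells (hH' K))
          exact ⟨b, fun _ P hP => hb μTx μRx P _ _ hP (hach K hK1 P hP)⟩
        · exact ⟨0, fun h => absurd h hK1⟩
      choose b hb using h
      refine WynerSym.limit_le_of_prelog_le (β := L) hb (fun K => ?_) hK hP
        (fun i => (continuous_fst.tendsto _).comp (hs i)) ((continuous_fst.tendsto _).comp hS)
      push_cast
      nlinarith [mul_le_mul_of_nonneg_right (WynerSym.card_evenCells_le K) (Nat.cast_nonneg (α := ℝ) L)]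
    · have h : ∀ K, ∃ b : ℝ, 1 ≤ K → ∀ P, 1 < P → K * (rF K P + rS K P)
          ≤ b + ((WynerSym.groupCells D K).card * L : ℕ) * (1 / 2 * Real.logb 2 P) := by
        intro K
        by_cases hK1 : 1 ≤ K
        · obtain ⟨b, hb⟩ := WynerSym.exists_sum_rate_le (D := D) hK1
            (WynerSym.determines_groupCells D (hH' K))
            fun k hk i h1 h2 => WynerSym.mem_groupCells_of_near hk h1 h2
          exact ⟨b, fun _ P hP => hb μTx μRx P _ _ hP (hach K hK1 P hP)⟩
        · exact ⟨0, fun h => absurd h hK1⟩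
      choose b hb using h
      refine WynerSym.limit_le_of_prelog_le (r := fun K P => rF K P + rS K P)
        (β := (6 * D + 10) * L) hb (fun K => ?_) hK hP (fun i => ?_)
        (((continuous_fst.add continuous_snd).tendsto _).comp hS)
      · push_cast
        nlinarith [mul_le_mul_of_nonneg_right (WynerSym.card_groupCells_le D K)
          (Nat.cast_nonneg (α := ℝ) L)]
      · simp only [add_div]
        exact ((continuous_fst.add continuous_snd).tendsto _).comp (hs i)
  · exact (isClosed_le continuous_fst continuous_const).inter
      (isClosed_le (continuous_fst.add continuous_snd) continuous_const)
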